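/- **Setting.** Let $\mathcal A$ be a Hamiltonian algebra: a complex unital $\star$-algebra, whose product $A\cdot B$ need not be commutative or associative, with a bilinear antisymmetric bracket $\{\cdot,\cdot\}$ that is a derivation, $\{H,A\cdot B\}=A\cdot\{H,B\}+\{H,A\}\cdot B$, and satisfies $\{A,B\}^\star=\{A^\star,B^\star\}$. Let $\mathcal L$ be a real linear space of states with a bilinear form $\langle\rho,A\rangle$ that satisfies $\langle\rho,A^\star\rangle=\overline{\langle\rho,A\rangle}$ and separates the points of $\mathcal A$, such that for every $H=H^\star\in\mathcal A$ there is an operator $\rho\mapsto\{\rho,H\}$ on $\mathcal L$ with $\langle\{\rho,H\},A\rangle=\langle\rho,\{H,A\}\rangle$. Let $\mathcal A^{\otimes n}$, $n\ge0$, be (completed) tensor powers of $\mathcal A$, realized as topological vector spaces of complex $n$-linear forms on $\mathcal L$, with $\mathcal A^{\otimes1}=\mathcal A$: the primitive elements $\bigotimes_iA_i:(\rho_1,\dots,\rho_n)\mapsto\prod_i\langle\rho_i,A_i\rangle$ span a dense subspace, the product and the bracket of $\mathcal A^{\otimes n}$ are the separately continuous bilinear extensions of $$\bigotimes_iH_i\cdot\bigotimes_iA_i=\bigotimes_iH_i\cdot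 A_i,\qquad \Big\{\bigotimes_iH_i,\bigotimes_iA_i\Big\}=\sum_j\bigotimes_{i\ne j}H_i\cdot A_i\otimes\{H_j,A_j\},$$ and tensoring with identities, permuting slots, evaluating one slot at a state, and evaluating all slots at states are continuous. Let $\mathcal A^{(n)}$ be the set of symmetric elements of $\mathcal A^{\otimes n}$. Write $\langle\rho^{\otimes m},W\rangle\in\mathcal A^{\otimes(n-m)}$ for the evaluation of $m$ slots of $W\in\mathcal A^{\otimes n}$ at $\rho$, and $\otimes_s$ for the symmetrized tensor product. A power series $\sum_n\frac1{n!}\langle\rho^{\otimes n},c_n\rangle$, $c_n\in\mathcal A^{(n)}$, is called entire if for all $\rho,\sigma\in\mathcal L$ its expansion at $r\rho+s\sigma$ in powers of $r,s$ converges absolutely at $r=s=1$. For $t$ in an open set $J\subseteq\mathbb R$ let $$\gamma(t,\rho)=\sum_{n\ge1}\frac1{n!}\langle\rho^{\otimes n},W^{(n)}(t)\rangle,\qquad W^{(n)}(t)\in\mathcal A^{(n)},$$ be a real polynomial or entire Hamilton functional with derivative $H(t,\rho)=\delta\gamma(t,\rho)\in\mathcal A$, i.e. $\frac{\partial}{\partial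 s}\gamma(t,\rho+s\sigma)|_{s=0}=\langle\sigma,H(t,\rho)\rangle$ for all $\sigma\in\mathcal L$. For $\varepsilon>0$ its $\varepsilon$-uniformization is the family $$H^{(n)}(t)=\sum_{m=1}^n\binom nm\varepsilon^{m-1}\,I^{\otimes(n-m)}\otimes_sW^{(m)}(t).$$ For a family $A^{(n)}(t)\in\mathcal A^{(n)}$, $n\ge0$, the abstract Heisenberg equations are $$\frac{\partial A^{(n)}(t)}{\partial t}=\{H^{(n)}(t),A^{(n)}(t)\},\qquad n=0,1,2,\dots,\ t\in J,\qquad(\mathrm W)$$ understood after pairing with all $\rho^{\otimes n}$, and the representing functional is $$\alpha(t,\rho)=e^{-\langle\rho,I\rangle/\varepsilon}\sum_{n\ge0}\frac1{n!\,\varepsilon^{n-1}}\langle\rho^{\otimes n},A^{(n)}(t)\rangle .$$ **Symbol and operator.** For $A\in\mathcal A$ let $$H(t,\rho\cdot(I+\varepsilon A))\equiv e^{\varepsilon\langle\rho,\delta\cdot A\rangle}H(t,\rho)=\sum_{k,a\ge0}\frac{\varepsilon^k}{k!\,a!}\Big\langle\rho^{\otimes k},\langle\rho^{\otimes a},W^{(1+k+a)}(t)\rangle\cdot(A^{\otimes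 k}\otimes I)\Big\rangle$$ and $G(t,\rho,A)=\langle\{\rho,H(t,\rho\cdot(I+\varepsilon A))\},A\rangle=\langle\rho,\{H(t,\rho\cdot(I+\varepsilon A)),A\}\rangle$, as expansions with terms indexed by $(k,a)$. A quantization of $G$ assigns to every $(k,a)$, $t\in J$ and $\rho$ a continuous linear functional on $\mathcal A^{\otimes(1+k)}$ whose value at every $A^{\otimes(1+k)}$ is the $(k,a)$ term of $G$ without the factor $\varepsilon^k$. The pseudodifferential operator $G(t,\rho,\delta)$ (derivations act first, multiplication by $\rho$ afterwards) is obtained by applying $\varepsilon^k$ times these functionals to $\delta^{\otimes(1+k)}\alpha(\rho)=\sum_b\frac1{b!}\langle\rho^{\otimes b},c_{1+k+b}\rangle$, when $\alpha(\rho)=\sum_n\frac1{n!}\langle\rho^{\otimes n},c_n\rangle$. Its homogeneous component of each degree in $\rho$ is a finite sum; its value at $\rho$ is the sum over all $(k,a,b)$. **Proposition.** 1. For each $n$ the part of $H(t,\rho\cdot(I+\varepsilon A))$ with $k+a=n$ is $\frac1{n!}\langle\rho^{\otimes n},W^{(1+n)}(t)\cdot((I+\varepsilon A)^{\otimes n}\otimes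 I)\rangle$, the literal substitution of $\rho\cdot(I+\varepsilon A)$ for $\rho$. A quantization of $G$ exists. Statements 2–4 hold for every quantization. 2. For every $\varepsilon>0$ and every family $A^{(n)}(t)\in\mathcal A^{(n)}$, the whole system $(\mathrm W)$ is equivalent to the single pseudodifferential equation $$\frac{\partial\alpha(t,\rho)}{\partial t}=\Big\langle\big\{\rho,H(t,\rho\cdot(I+\varepsilon\delta))\big\},\delta\Big\rangle\,\alpha(t,\rho)\qquad(\mathrm Z)$$ on $J$, where $\alpha(t,\cdot)$ is taken as a formal power series in $\rho$ and $(\mathrm Z)$ is read between homogeneous components. If moreover, for every $\rho$, the series for $\alpha(t,\rho)$ and the series over $(k,a,b)$ for the right side of $(\mathrm Z)$ are dominated, locally uniformly in $t$, by convergent series, then $(\mathrm W)$ is equivalent to $(\mathrm Z)$ as an equation between the values at every $\rho\in\mathcal L$ and $t\in J$. 3. As $\varepsilon\to0^+$, equation $(\mathrm Z)$ reduces to the first-order equation $$\frac{\partial}{\partial t}\alpha(t,\rho)=\langle\{\rho,H(t,\rho)\},\delta\rangle\,\alpha(t,\rho).$$ That is, for every $t\in J$ and every fixed formal power series $\alpha$,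 each homogeneous component of $G(t,\rho,\delta)\alpha$ converges to that of $\sum_{a,b}\frac1{a!\,b!}\langle\rho,\{\langle\rho^{\otimes a},W^{(1+a)}(t)\rangle,\langle\rho^{\otimes b},c_{1+b}\rangle\}\rangle$, the expansion of $\langle\{\rho,H(t,\rho)\},\delta\rangle\alpha$. If $\alpha$ is entire and, at a given $t\in J$ and $\rho$, the series for $G(t,\rho,\delta)\alpha$ converges absolutely for some $\varepsilon_0>0$, then $\alpha$ has a derivative at $\rho$ in the direction $\{\rho,H(t,\rho)\}$ and $G(t,\rho,\delta)\alpha$ tends to it as $\varepsilon\to0^+$. 4. For $\alpha(t)=\langle\rho(t),A\rangle$ the first-order equation is the weak form of the abstract Vlasov equation $\partial\rho(t)/\partial t=\{\rho(t),H(t,\rho(t))\}$: a curve $\rho(t)$ in $\mathcal L$ satisfies $\frac{d}{dt}\langle\rho(t),A\rangle=\langle\{\rho(t),H(t,\rho(t))\},A\rangle$ for all $A\in\mathcal A$, $t\in J$, if and only if for all $A\in\mathcal A$, $t\in J$ the derivative $\frac{d}{dt}\langle\rho(t),A\rangle$ is the value at $\rho=\rho(t)$ of $\langle\{\rho,H(t,\rho)\},\delta\rangle$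 applied to the linear functional $\rho\mapsto\langle\rho,A\rangle$. -/

import Mathlib

open scoped Topology Nat

noncomputable section

namespace Uniformization

/-! ### Hamiltonian algebras and their state spaces -/

section Basic

variable (L A : Type*) [AddCommGroup L] [Module ℝ L]
  [NonAssocRing A] [StarRing A] [Module ℂ A]

/-- The Poisson bracket of a Hamiltonian algebra: `A` is a complex unital `⋆`-algebra, with a
product that need not be commutative or associative, and `{H, A}` is bilinear, antisymmetric, a
derivation of the product, and compatible with the involution. No Jacobi identity is required. -/
structure PoissonBracket where
  br : A →ₗ[ℂ] A →ₗ[ℂ] A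
  antisymm : ∀ x y, br x y = -br y x
  leibniz : ∀ h x y, br h (x * y) = x * br h y + br h x * y
  star_br : ∀ x y, star (br x y) = br (star x) (star y)

/-- A real linear space `L` of states of the Hamiltonian algebra `A`: a bilinear form `⟨ρ, A⟩`, real
for `A = A⋆`, through which the elements of `A` are functionals on `L`, and for every real `H` the
operator `ρ ↦ {ρ, H}` on `L` that is predual to the derivation `A ↦ {H, A}`. -/
structure StateSpace (P : PoissonBracket A) where
  pair : L →ₗ[ℝ] A →ₗ[ℂ] ℂ
  pair_star : ∀ ρ x, pair ρ (star x) = starRingEnd ℂ (pair ρ x)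
  separating : ∀ x, (∀ ρ, pair ρ x = 0) → x = 0
  poisson : L → A → L
  poisson_spec : ∀ ρ h, star h = h → ∀ x, pair (poisson ρ h) x = pair ρ (P.br h x)

/-- Complex `n`-linear forms on `L`, i.e. linear forms on the `n`-th tensor power of `L`. -/
abbrev Form (n : ℕ) := MultilinearMap ℝ (fun _ : Fin n => L) ℂ

end Basic

section Forms

variable {L A : Type*} [AddCommGroup L] [Module ℝ L]
  [NonAssocRing A] [StarRing A] [Module ℂ A] {P : PoissonBracket A}

/-- The element `x ∈ A` as a linear form `ρ ↦ ⟨ρ, x⟩` on `L`. -/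
def StateSpace.lin (S : StateSpace L A P) (x : A) : L →ₗ[ℝ] ℂ where
  toFun ρ := S.pair ρ x
  map_add' ρ σ := by simp
  map_smul' r ρ := by simp

/-- The primitive element `x₁ ⊗ ⋯ ⊗ xₙ`: the form `(ρ₁, …, ρₙ) ↦ ⟨ρ₁, x₁⟩ ⋯ ⟨ρₙ, xₙ⟩`. -/
def StateSpace.primitive (S : StateSpace L A P) {n : ℕ} (x : Fin n → A) : Form L n :=
  (MultilinearMap.mkPiAlgebra ℝ (Fin n) ℂ).compLinearMap fun i => S.lin (x i)

/-- The factor of the identities in `ampliateForm`. -/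
def StateSpace.onesFactor (S : StateSpace L A P) {m n : ℕ} (f : Fin m ↪ Fin n) (v : Fin n → L) : ℂ :=
  open Classical in ∏ i, if i ∈ Set.range f then (1 : ℂ) else S.pair (v i) 1

theorem StateSpace.onesFactor_of_mem (S : StateSpace L A P) {m n : ℕ} (f : Fin m ↪ Fin n)
    [DecidableEq (Fin n)] (v : Fin n → L) (j : Fin m) (z : L) :
    S.onesFactor f (Function.update v (f j) z) = S.onesFactor f v := by
  classical
  refine Finset.prod_congr rfl fun k _ => ?_
  by_cases hk : k ∈ Set.range f
  · simp only [hk, if_true]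
  · have : k ≠ f j := fun h => hk (h ▸ ⟨j, rfl⟩)
    simp only [hk, if_false, Function.update_of_ne this]

theorem StateSpace.onesFactor_of_not_mem (S : StateSpace L A P) {m n : ℕ} (f : Fin m ↪ Fin n)
    [DecidableEq (Fin n)] (v : Fin n → L) (i : Fin n) (hi : i ∉ Set.range f) :
    ∃ c : ℂ, ∀ z : L, S.onesFactor f (Function.update v i z) = S.pair z 1 * c := by
  classical
  refine ⟨∏ k ∈ Finset.univ.erase i, if k ∈ Set.range f then (1 : ℂ) else S.pair (v k) 1,
    fun z => ?_⟩
  rw [StateSpace.onesFactor, ← Finset.mul_prod_erase Finset.univ _ (Finset.mem_univ i)]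
  congr 1
  · simp only [hi, if_false, Function.update_self]
  · refine Finset.prod_congr rfl fun k hk => ?_
    rw [Function.update_of_ne (Finset.ne_of_mem_erase hk)]
    by_cases h : k ∈ Set.range f
    · simp only [h, if_true]
    · simp only [h, if_false]

/-- `W` placed in the slots `f 1, …, f m` and the identity `I` in all other slots: the form
`(ρ₁, …, ρₙ) ↦ W (ρ_{f 1}, …, ρ_{f m}) ∏_{i ∉ range f} ⟨ρᵢ, I⟩`. For `m = n` this permutes slots. -/
def StateSpace.ampliateForm (S : StateSpace L A P) {m n : ℕ} (f : Fin m ↪ Fin n) (W : Form L m) :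
    Form L n where
  toFun v := W (fun j => v (f j)) * S.onesFactor f v
  map_update_add' v i x y := by
    by_cases hi : i ∈ Set.range f
    · obtain ⟨j, rfl⟩ := hi
      have h (z : L) : (fun k => Function.update v (f j) z (f k)) =
          Function.update (fun k => v (f k)) j z :=
        Function.update_comp_eq_of_injective v f.injective j z
      simp only [h, S.onesFactor_of_mem, W.map_update_add, add_mul]
    · have h (z : L) : (fun k => Function.update v i z (f k)) = fun k => v (f k) :=
        Function.update_comp_eq_of_notMem_range v z hi
      obtain ⟨c, hc⟩ := S.onesFactor_of_not_mem f v i hi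
      simp only [h, hc, map_add, LinearMap.add_apply]
      ring
  map_update_smul' v i r x := by
    by_cases hi : i ∈ Set.range f
    · obtain ⟨j, rfl⟩ := hi
      have h (z : L) : (fun k => Function.update v (f j) z (f k)) =
          Function.update (fun k => v (f k)) j z :=
        Function.update_comp_eq_of_injective v f.injective j z
      simp only [h, S.onesFactor_of_mem, W.map_update_smul, smul_mul_assoc]
    · have h (z : L) : (fun k => Function.update v i z (f k)) = fun k => v (f k) :=
        Function.update_comp_eq_of_notMem_range v z hi
      obtain ⟨c, hc⟩ := S.onesFactor_of_not_mem f v i hi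
      simp only [h, hc, map_smul, LinearMap.smul_apply, smul_mul_assoc, mul_smul_comm]

end Forms

/-! ### The `n`-particle algebras -/

section Particles

variable {L A : Type*} [AddCommGroup L] [Module ℝ L]
  [NonAssocRing A] [StarRing A] [Module ℂ A] {P : PoissonBracket A}

/-- The (completed) tensor powers `A^{⊗n}`, realized as topological vector spaces `obs n` of
`n`-linear forms on `L`. The primitive elements span a dense subspace, the product and the bracket
are the separately continuous bilinear extensions of their values on primitive elements
`(⊗ xᵢ) · (⊗ yᵢ) = ⊗ xᵢ yᵢ`, `{⊗ xᵢ, ⊗ yᵢ} = ∑ⱼ (⊗_{i ≠ j} xᵢ yᵢ) ⊗ {xⱼ, yⱼ}`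
(which determines them, see `bilin_ext`), and tensoring with identities, permuting slots, evaluating
one slot or all slots at states are continuous. In degree one it is `A` itself. Instances are the
algebraic tensor powers of `A` with the finest locally convex topology, all forms if `A` is the
complexified dual of a finite dimensional `L`, smooth functions on powers of a phase space paired with compactly supported
distributions. -/
structure ParticleAlgebras (S : StateSpace L A P) where
  obs : ∀ n, Submodule ℂ (Form L n)
  [top : ∀ n, TopologicalSpace (obs n)]
  [addGroup : ∀ n, IsTopologicalAddGroup (obs n)]
  [smul : ∀ n, ContinuousSMul ℂ (obs n)]
  primitive_mem : ∀ {n : ℕ} (x : Fin n → A), S.primitive x ∈ obs n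
  dense : ∀ n, Dense
    (Submodule.span ℂ (Set.range fun x : Fin n → A => (⟨S.primitive x, primitive_mem x⟩ : obs n)) :
      Set (obs n))
  mul : ∀ n, obs n →ₗ[ℂ] obs n →ₗ[ℂ] obs n
  mul_continuous_left : ∀ n Y, Continuous fun X => mul n X Y
  mul_continuous_right : ∀ n X, Continuous fun Y => mul n X Y
  mul_primitive : ∀ {n : ℕ} (x y : Fin n → A),
    mul n ⟨S.primitive x, primitive_mem x⟩ ⟨S.primitive y, primitive_mem y⟩ =
      ⟨S.primitive fun i => x i * y i, primitive_mem _⟩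
  br : ∀ n, obs n →ₗ[ℂ] obs n →ₗ[ℂ] obs n
  br_continuous_left : ∀ n Y, Continuous fun X => br n X Y
  br_continuous_right : ∀ n X, Continuous fun Y => br n X Y
  br_primitive : ∀ {n : ℕ} (x y : Fin n → A),
    br n ⟨S.primitive x, primitive_mem x⟩ ⟨S.primitive y, primitive_mem y⟩ =
      ∑ j, ⟨S.primitive (Function.update (fun i => x i * y i) j (P.br (x j) (y j))),
        primitive_mem _⟩
  ampliate_mem : ∀ {m n : ℕ} (f : Fin m ↪ Fin n) (W : obs m), S.ampliateForm f W ∈ obs n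
  ampliate_continuous : ∀ {m n : ℕ} (f : Fin m ↪ Fin n),
    Continuous fun W : obs m => (⟨S.ampliateForm f W, ampliate_mem f W⟩ : obs n)
  slice_mem : ∀ {n : ℕ} (ρ : L) (W : obs (n + 1)), (W : Form L (n + 1)).curryLeft ρ ∈ obs n
  slice_continuous : ∀ {n : ℕ} (ρ : L), Continuous fun W : obs (n + 1) =>
    (⟨(W : Form L (n + 1)).curryLeft ρ, slice_mem ρ W⟩ : obs n)
  eval_continuous : ∀ {n : ℕ} (v : Fin n → L), Continuous fun W : obs n => (W : Form L n) v
  obs_one : ∀ W : obs 1, ∃ x : A, (W : Form L 1) = S.primitive fun _ => x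

attribute [instance] ParticleAlgebras.top ParticleAlgebras.addGroup ParticleAlgebras.smul

namespace ParticleAlgebras

variable {S : StateSpace L A P} (E : ParticleAlgebras S)

/-- The primitive element `x₁ ⊗ ⋯ ⊗ xₙ` of `A^{⊗n}`. -/
def tprod {n : ℕ} (x : Fin n → A) : E.obs n := ⟨S.primitive x, E.primitive_mem x⟩

/-- Separately continuous bilinear maps on `A^{⊗n}` are determined by their values on primitive
elements; in particular the product and the bracket of `A^{⊗n}` are. -/
theorem bilin_ext {n : ℕ} (F G : E.obs n →ₗ[ℂ] E.obs n →ₗ[ℂ] E.obs n)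
    (hF₁ : ∀ Y, Continuous fun X => F X Y) (hF₂ : ∀ X, Continuous fun Y => F X Y)
    (hG₁ : ∀ Y, Continuous fun X => G X Y) (hG₂ : ∀ X, Continuous fun Y => G X Y)
    (h : ∀ x y : Fin n → A, F (E.tprod x) (E.tprod y) = G (E.tprod x) (E.tprod y)) : F = G := by
  have sep : ∀ f g : E.obs n →ₗ[ℂ] E.obs n, Continuous f → Continuous g →
      (∀ x : Fin n → A, f (E.tprod x) = g (E.tprod x)) → f = g := by
    intro f g hf hg hfg
    have hspan : ∀ X ∈ Submodule.span ℂ (Set.range fun x : Fin n → A => E.tprod x), f X = g X := by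
      intro X hX
      induction hX using Submodule.span_induction with
      | mem X hX => obtain ⟨x, rfl⟩ := hX; exact hfg x
      | zero => simp
      | add X Y _ _ hX hY => simp [hX, hY]
      | smul c X _ hX => simp [hX]
    refine LinearMap.ext fun X => Subtype.ext (MultilinearMap.ext fun v => ?_)
    have := Continuous.ext_on (E.dense n) ((E.eval_continuous v).comp hf)
      ((E.eval_continuous v).comp hg) (fun X hX => by simp [hspan X hX])
    exact congrFun this X
  refine LinearMap.ext fun X => sep _ _ (hF₂ X) (hG₂ X) fun y => ?_
  have := sep (F.flip (E.tprod y)) (G.flip (E.tprod y)) (hF₁ _) (hG₁ _) (fun x => h x y)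
  exact LinearMap.congr_fun this X

/-- `ampliateForm` as an operation on observables. -/
def ampliate {m n : ℕ} (f : Fin m ↪ Fin n) (W : E.obs m) : E.obs n :=
  ⟨S.ampliateForm f W, E.ampliate_mem f W⟩

/-- `I^{(n-m)} ⊗ₛ W`, the symmetrization of `I ⊗ ⋯ ⊗ I ⊗ W`: the average over all ways of placing
the slots of `W` among the `n` slots. -/
def symTensorOne {m : ℕ} (n : ℕ) (W : E.obs m) : E.obs n :=
  ((Fintype.card (Fin m ↪ Fin n) : ℂ))⁻¹ • ∑ f : Fin m ↪ Fin n, E.ampliate f W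

/-- `⟨ρ^{⊗m}, W⟩ ∈ A^{⊗n}` for `W ∈ A^{⊗(n+m)}`: the first `m` slots are evaluated at `ρ`. -/
def contract (ρ : L) {n : ℕ} : (m : ℕ) → E.obs (n + m) → E.obs n
  | 0, W => W
  | m + 1, W => contract ρ m
      ⟨(W : Form L (n + m + 1)).curryLeft ρ, E.slice_mem ρ W⟩

/-- `⟨ρ^{⊗n}, W⟩`. -/
def diag {n : ℕ} (ρ : L) (W : E.obs n) : ℂ := (W : Form L n) fun _ => ρ

/-- Symmetric elements: the algebra `A^{(n)}` consists of the symmetric elements of `A^{⊗n}`. -/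
def IsSymm {n : ℕ} (W : E.obs n) : Prop :=
  ∀ (σ : Equiv.Perm (Fin n)) (v : Fin n → L), (W : Form L n) (fun i => v (σ i)) = (W : Form L n) v

/-! ### Functionals on `L` given by power series -/

/-- The functional `ρ ↦ ∑ₙ (1/n!) ⟨ρ^{⊗n}, cₙ⟩` with derivatives `cₙ` at `ρ = 0`. -/
def toFunctional (c : ∀ n, E.obs n) (ρ : L) : ℂ := ∑' n : ℕ, E.diag ρ (c n) / n !

/-- The functional `∑ₙ (1/n!) ⟨ρ^{⊗n}, cₙ⟩` is entire: its Taylor series in the two variables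
`(r, s) ↦ r ρ + s σ` converges absolutely for all `ρ`, `σ`. -/
def IsEntire (c : ∀ n, E.obs n) : Prop :=
  ∀ ρ σ : L, Summable fun p : ℕ × ℕ =>
    ‖E.diag ρ (E.contract σ p.2 (c (p.1 + p.2)))‖ / ((p.1)! * (p.2)!)

/-- `γ(ρ) = ∑_{n ≥ 1} (1/n!) ⟨ρ^{⊗n}, W^{(n)}⟩`. -/
def hamiltonFunctional (W : ∀ n, E.obs n) (ρ : L) : ℂ :=
  ∑' n : ℕ, E.diag ρ (W (n + 1)) / (n + 1)!

/-- `γ(t, ρ) = ∑_{n ≥ 1} (1/n!) ⟨ρ^{⊗n}, W^{(n)}(t)⟩`, `t ∈ J`, is a real polynomial or entire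
Hamilton functional, `A`-smooth with derivative (Vlasov Hamiltonian) `H(t, ρ) = δγ(t, ρ) ∈ A`. -/
structure IsHamiltonFunctional (J : Set ℝ) (W : ℝ → ∀ n, E.obs n) (H : ℝ → L → A) : Prop where
  symm : ∀ t ∈ J, ∀ n, E.IsSymm (W t n)
  entire : ∀ t ∈ J, E.IsEntire (W t)
  real : ∀ t ∈ J, ∀ ρ, (E.hamiltonFunctional (W t) ρ).im = 0
  deriv : ∀ t ∈ J, ∀ ρ σ,
    HasLineDerivAt ℝ (E.hamiltonFunctional (W t)) (S.pair σ (H t ρ)) ρ σ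

/-! ### Uniformization, Heisenberg equations, representing functionals -/

/-- The `ε`-uniformization
`H^{(n)} = ∑_{m=1}^{n} (n choose m) ε^{m-1} I^{(n-m)} ⊗ₛ W^{(m)}`. -/
def uniformize (ε : ℝ) (W : ∀ n, E.obs n) (n : ℕ) : E.obs n :=
  ∑ m ∈ Finset.Icc 1 n, ((n.choose m : ℂ) * (ε : ℂ) ^ (m - 1)) • E.symTensorOne n (W m)

/-- The system `∂A^{(n)}/∂t = {H^{(n)}, A^{(n)}}`, `n = 0, 1, 2, …`, in `A^{(n)}` as a space of
functionals on the span `L_n` of the powers `ρ^{⊗n}`. -/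
def Heisenberg (ε : ℝ) (J : Set ℝ) (W : ℝ → ∀ n, E.obs n) (X : ℝ → ∀ n, E.obs n) : Prop :=
  ∀ n, ∀ t ∈ J, ∀ ρ : L, HasDerivAt (fun τ => E.diag ρ (X τ n))
    (E.diag ρ (E.br n (E.uniformize ε (W t) n) (X t n))) t

/-- The `n`-th term `⟨ρ^{⊗n}, A^{(n)}⟩ / (n! ε^{n-1})` of the representing functional. -/
def repTerm (ε : ℝ) (X : ∀ n, E.obs n) (ρ : L) (n : ℕ) : ℂ :=
  E.diag ρ (X n) * (ε / (n ! * (ε : ℂ) ^ n))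

/-- The representing functional
`α(ρ) = exp(-⟨ρ, I⟩/ε) ∑ₙ ⟨ρ^{⊗n}, A^{(n)}⟩ / (n! ε^{n-1})`. -/
def representing (ε : ℝ) (X : ∀ n, E.obs n) (ρ : L) : ℂ :=
  Complex.exp (-(S.pair ρ 1 / ε)) * ∑' n, E.repTerm ε X ρ n

/-- The derivatives of the representing functional at `ρ = 0`, i.e. the coefficients of the product
of the power series of `exp(-⟨ρ, I⟩/ε)` and `∑ₙ ⟨ρ^{⊗n}, A^{(n)}⟩ / (n! ε^{n-1})`. -/
def repForm (ε : ℝ) (X : ∀ n, E.obs n) (n : ℕ) : E.obs n :=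
  ∑ m ∈ Finset.range (n + 1),
    ((n.choose m : ℂ) * (-(1 / (ε : ℂ))) ^ (n - m) * (ε / (ε : ℂ) ^ m)) • E.symTensorOne n (X m)

/-! ### The symbol and the pseudodifferential operator -/

/-- With `H(ρ) = ∑ₙ (1/n!) ⟨ρ^{⊗n}, W^{(n+1)}⟩`, the symbol-Hamiltonian is
`H(ρ · (I + ε x)) = exp(ε ⟨ρ, δ · x⟩) H(ρ) = ∑ₖ (εᵏ/k!) ⟨ρ^{⊗k}, δ^{⊗k} H(ρ) · x^{⊗k}⟩`, where the
products are taken in the `k` slots of `δ^{⊗k}` and `δ^{⊗k} H(ρ) = ∑ₐ (1/a!) ⟨ρ^{⊗a}, W^{(1+k+a)}⟩`.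
This is the term of index `(k, a)`, without its factor `εᵏ`. -/
def symbolHamiltonian (W : ∀ n, E.obs n) (k a : ℕ) (ρ : L) (x : A) : E.obs 1 :=
  (1 / ((k ! : ℂ) * a !)) • E.contract ρ k
    (E.mul (1 + k) (E.contract ρ a (W (1 + k + a)))
      (E.tprod fun i : Fin (1 + k) => if i.val < k then x else 1))

/-- The term of index `(k, a)`, without its factor `εᵏ`, of the symbol
`G(ρ, x) = ⟨{ρ, H(ρ · (I + ε x))}, x⟩ = ⟨ρ, {H(ρ · (I + ε x)), x}⟩`;
it is homogeneous of degree `1 + k` in `x`, and of degree `1 + k + a` in `ρ`. -/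
def symbol (W : ∀ n, E.obs n) (k a : ℕ) (ρ : L) (x : A) : ℂ :=
  E.diag ρ (E.br 1 (E.symbolHamiltonian W k a ρ x) (E.tprod fun _ => x))

/-- Substitution of `δ` for `x` in the symbol: `g k a t ρ` is a continuous linear functional on
`A^{⊗(1+k)}` whose value on `x^{⊗(1+k)}` is the part of index `(k, a)` of the symbol. -/
def Quantizes (J : Set ℝ) (W : ℝ → ∀ n, E.obs n)
    (g : ∀ k : ℕ, ℕ → ℝ → L → (E.obs (1 + k) →L[ℂ] ℂ)) : Prop :=
  ∀ (k a : ℕ), ∀ t ∈ J, ∀ (ρ : L) (x : A),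
    g k a t ρ (E.tprod fun _ => x) = E.symbol (W t) k a ρ x

/-- The operator with symbol `G`, differentiations acting first, applied to the functional
`α(ρ) = ∑ₙ (1/n!) ⟨ρ^{⊗n}, cₙ⟩`: in the part of index `(k, a)` of the symbol `x^{⊗(1+k)}` is
replaced by `δ^{⊗(1+k)} α(ρ) = ∑_b (1/b!) ⟨ρ^{⊗b}, c_{1+k+b}⟩`. This is the term of index
`p = (k, a, b)`; it is homogeneous of degree `1 + k + a + b` in `ρ`. -/
def opTerm (ε : ℝ) (g : ∀ k : ℕ, ℕ → ℝ → L → (E.obs (1 + k) →L[ℂ] ℂ)) (t : ℝ)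
    (c : ∀ n, E.obs n) (ρ : L) (p : ℕ × ℕ × ℕ) : ℂ :=
  (ε : ℂ) ^ p.1 * g p.1 p.2.1 t ρ (E.contract ρ p.2.2 (c (1 + p.1 + p.2.2))) / (p.2.2)!

/-- The value at `ρ` of the operator with symbol `G` applied to `∑ₙ (1/n!) ⟨ρ^{⊗n}, cₙ⟩`. -/
def op (ε : ℝ) (g : ∀ k : ℕ, ℕ → ℝ → L → (E.obs (1 + k) →L[ℂ] ℂ)) (t : ℝ)
    (c : ∀ n, E.obs n) (ρ : L) : ℂ := ∑' p, E.opTerm ε g t c ρ p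

/-- The index triples `(k, a, b)` of the terms of degree `d` in `ρ`. -/
def degreeIndices (d : ℕ) : Finset (ℕ × ℕ × ℕ) :=
  (Finset.range d ×ˢ Finset.range d ×ˢ Finset.range d).filter
    fun p => 1 + p.1 + p.2.1 + p.2.2 = d

/-- The homogeneous component of degree `d` in `ρ` of the operator with symbol `G` applied to the
formal power series `∑ₙ (1/n!) ⟨ρ^{⊗n}, cₙ⟩`; it is a finite sum. -/
def opComponent (ε : ℝ) (g : ∀ k : ℕ, ℕ → ℝ → L → (E.obs (1 + k) →L[ℂ] ℂ)) (t : ℝ)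
    (c : ∀ n, E.obs n) (ρ : L) (d : ℕ) : ℂ := ∑ p ∈ degreeIndices d, E.opTerm ε g t c ρ p

/-- The pseudodifferential equation `∂α/∂t = ⟨{ρ, H(t, ρ · (I + ε δ))}, δ⟩ α` for power series
`α(t, ρ) = ∑ₙ (1/n!) ⟨ρ^{⊗n}, cₙ(t)⟩`, which need not converge: an equation between homogeneous
components. -/
def FormalEquation (ε : ℝ) (J : Set ℝ) (g : ∀ k : ℕ, ℕ → ℝ → L → (E.obs (1 + k) →L[ℂ] ℂ))
    (c : ℝ → ∀ n, E.obs n) : Prop :=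
  ∀ d : ℕ, ∀ t ∈ J, ∀ ρ : L,
    HasDerivAt (fun τ => E.diag ρ (c τ d) / d !) (E.opComponent ε g t (c t) ρ d) t

/-- The representing functionals of `X t` converge absolutely, locally uniformly in `t`, and so does
the operator with symbol `G` applied to them. -/
structure IsRegular (ε : ℝ) (J : Set ℝ) (g : ∀ k : ℕ, ℕ → ℝ → L → (E.obs (1 + k) →L[ℂ] ℂ))
    (X : ℝ → ∀ n, E.obs n) : Prop where
  rep : ∀ t₀ ∈ J, ∀ ρ, ∃ u : ℕ → ℝ, Summable u ∧
    ∀ᶠ t in 𝓝 t₀, ∀ n, ‖E.repTerm ε (X t) ρ n‖ ≤ u n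
  op : ∀ t₀ ∈ J, ∀ ρ, ∃ u : ℕ × ℕ × ℕ → ℝ, Summable u ∧
    ∀ᶠ t in 𝓝 t₀, ∀ p, ‖E.opTerm ε g t (E.repForm ε (X t)) ρ p‖ ≤ u p

end ParticleAlgebras

/-- Weak form of the Vlasov equation `∂ρ(t)/∂t = {ρ(t), H(t, ρ(t))}`. -/
def WeakVlasov (S : StateSpace L A P) (J : Set ℝ) (H : ℝ → L → A) (ρ : ℝ → L) : Prop :=
  ∀ t ∈ J, ∀ x : A, HasDerivAt (fun τ => S.pair (ρ τ) x)
    (S.pair (S.poisson (ρ t) (H t (ρ t))) x) t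

end Particles

end Uniformization

end

open scoped Topology Nat

noncomputable section

namespace Uniformization

/-! ### Polarization -/

section Polarization

/-! The algebraic identities behind the equivalence are linear and continuous in the family `W` and,
separately, in the family of observables. By polarization, density of the primitive elements and a
scaling argument, such identities hold for all symmetric families once they hold for families of
powers `n ↦ x ⊗ ⋯ ⊗ x` (`functional_eq_zero_of_tpow`, `family_ext`). On powers every operation
reduces to numbers `⟨ρ, ·⟩`.

For powers of `w` in the Hamiltonian and of `z` in the observables, the uniformization is `((1 +
εw)^{⊗n} - 1^{⊗n})/ε`, and since `{1, ·} = 0` its bracket with `z^{⊗n}` pairs with `ρ^{⊗n}` to `n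
⟨ρ, z + εwz⟩^{n-1} ⟨ρ, {w, z}⟩`. The representing functional has derivatives `ε y^{⊗n}` at `0`, with
`y = (z - 1)/ε`. The term `(k, a, b)` of the operator becomes `⟨ρ, {w, z}⟩ (ε⟨ρ, wy⟩)^k ⟨ρ, w⟩^a ⟨ρ,
y⟩^b / (k! a! b!)`. The trinomial theorem sums these in each degree, and the base `⟨ρ, εwy + w + y⟩`
equals `(⟨ρ, z + εwz⟩ - ⟨ρ, 1⟩)/ε`; its binomial expansion is the combination of Heisenberg right
sides prescribed by the factor `exp(-⟨ρ, I⟩/ε)` (`opComponent_repForm`).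

Thus one time-independent triangular matrix with nonzero diagonal carries both the Heisenberg
unknowns and their right sides to the components of the pseudodifferential equation
(`hasDerivAt_triangular_iff`). Passing between components and values amounts to reading the equation
along the rays `rρ` as an identity of power series in `r`, where local uniform domination permits
termwise differentiation and extraction of coefficients
(`hasDerivAt_coeff_iff_hasDerivAt_powerSeries`).

As `ε → 0` only the terms with `k = 0` survive; for functionals this is dominated convergence with
the series at `ε₀` as majorant. Identifying the limit needs the bracket with `x` to commute with the
series for `H(t, ρ)`, which is obtained by moving the bracket onto the state (`hasSum_pair_br`). -/

/-- Toggling membership of a point `j` outside the range of `f` is a sign-reversing involution on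
the sets counted. -/
theorem sum_neg_one_pow_card_filter_range_subset {n : ℕ} {f : Fin n → Fin n}
    (hf : ¬ Function.Surjective f) :
    ∑ s : Finset (Fin n), (if ∀ i, f i ∈ s then (-1 : ℂ) ^ s.card else 0) = 0 := by
  obtain ⟨j, hj⟩ : ∃ j, ∀ i, f i ≠ j := by simpa [Function.Surjective] using hf
  have hmem (s : Finset (Fin n)) : (∀ i, f i ∈ symmDiff s {j}) ↔ ∀ i, f i ∈ s := by
    refine forall_congr' fun i => ?_
    simp [Finset.mem_symmDiff, hj i]
  have hcard (s : Finset (Fin n)) :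
      (-1 : ℂ) ^ s.card + (-1 : ℂ) ^ (symmDiff s {j}).card = 0 := by
    by_cases h : j ∈ s
    · have h1 : symmDiff s {j} = s.erase j := by ext i; grind [Finset.mem_symmDiff]
      rw [h1, ← Finset.card_erase_add_one h, pow_succ]; ring
    · have h1 : symmDiff s {j} = insert j s := by ext i; grind [Finset.mem_symmDiff]
      rw [h1, Finset.card_insert_of_notMem h, pow_succ]; ring
  refine Finset.sum_involution (fun s _ => symmDiff s {j}) ?_ ?_ ?_ ?_
  · intro s _
    by_cases h : ∀ i, f i ∈ s
    · simp only [hmem, h, implies_true, if_true, hcard]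
    · simp only [hmem, h, if_false, add_zero]
  · intro s _ _ h
    have : j ∈ symmDiff s {j} ↔ j ∈ s := by rw [h]
    simp [Finset.mem_symmDiff] at this
  · simp
  · intro s _
    simp

/-- A symmetric multilinear form that vanishes on the diagonal is zero. -/
theorem multilinear_eq_zero_of_diag {R V : Type*} [CommSemiring R] [AddCommMonoid V] [Module R V]
    [Module R ℂ] {n : ℕ} (M : MultilinearMap R (fun _ : Fin n => V) ℂ)
    (hsymm : ∀ (σ : Equiv.Perm (Fin n)) (v : Fin n → V), M (fun i => v (σ i)) = M v)
    (hdiag : ∀ v : V, M (fun _ => v) = 0) : M = 0 := by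
  classical
  refine MultilinearMap.ext fun x => ?_
  -- Expansion of the vanishing diagonal value of `M` at `∑ j ∈ s, x j`. Inclusion–exclusion over
  -- `s` then leaves only the surjective `f`, which are permutations and by symmetry all contribute
  -- `M x * (-1) ^ n`.
  have h1 (s : Finset (Fin n)) : ∑ f : Fin n → Fin n,
      (if ∀ i, f i ∈ s then M (fun i => x (f i)) else 0) = 0 := by
    have := M.map_sum_finset (fun _ j => x j) (fun _ => s)
    rw [hdiag] at this
    rw [← Finset.sum_filter, this]
    refine Finset.sum_congr ?_ fun _ _ => rfl
    ext f; simp [Fintype.mem_piFinset]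
  have h2 : ∑ f : Fin n → Fin n, M (fun i => x (f i)) *
      ∑ s : Finset (Fin n), (if ∀ i, f i ∈ s then (-1 : ℂ) ^ s.card else 0) = 0 := by
    simp_rw [Finset.mul_sum]
    rw [Finset.sum_comm]
    refine Finset.sum_eq_zero fun s _ => ?_
    have := congrArg ((-1 : ℂ) ^ s.card * ·) (h1 s)
    simp only [Finset.mul_sum, mul_zero] at this
    refine Eq.trans (Finset.sum_congr rfl fun f _ => ?_) this
    split_ifs
    · exact mul_comm _ _
    · simp
  have h3 (f : Fin n → Fin n) : M (fun i => x (f i)) *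
      ∑ s : Finset (Fin n), (if ∀ i, f i ∈ s then (-1 : ℂ) ^ s.card else 0) =
      if Function.Surjective f then M x * (-1) ^ n else 0 := by
    split_ifs with hf
    · have hb : Function.Bijective f := Finite.surjective_iff_bijective.mp hf
      have hs (s : Finset (Fin n)) : (∀ i, f i ∈ s) ↔ s = Finset.univ := by
        rw [Finset.eq_univ_iff_forall]
        exact hf.forall.symm
      have := hsymm (Equiv.ofBijective f hb) x
      simp only [Equiv.ofBijective_apply] at this
      simp only [hs, Finset.sum_ite_eq', Finset.mem_univ, if_true, Finset.card_univ,
        Fintype.card_fin]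
      rw [this]
    · rw [sum_neg_one_pow_card_filter_range_subset hf, mul_zero]
  rw [Finset.sum_congr rfl fun f _ => h3 f] at h2
  rw [← Finset.sum_filter, Finset.sum_const, nsmul_eq_mul] at h2
  have hc : ((Finset.univ.filter fun f : Fin n → Fin n => Function.Surjective f).card : ℂ) ≠ 0 := by
    have : id ∈ Finset.univ.filter fun f : Fin n → Fin n => Function.Surjective f := by
      simp [Function.surjective_id]
    exact_mod_cast (Finset.card_pos.mpr ⟨_, this⟩).ne'
  simpa [hc] using h2

theorem multilinear_ext_of_diag {R V : Type*} [CommRing R] [AddCommMonoid V] [Module R V]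
    [Module R ℂ] {n : ℕ} {M N : MultilinearMap R (fun _ : Fin n => V) ℂ}
    (hM : ∀ (σ : Equiv.Perm (Fin n)) (v : Fin n → V), M (fun i => v (σ i)) = M v)
    (hN : ∀ (σ : Equiv.Perm (Fin n)) (v : Fin n → V), N (fun i => v (σ i)) = N v)
    (hdiag : ∀ v : V, M (fun _ => v) = N (fun _ => v)) : M = N := by
  rw [← sub_eq_zero]
  exact multilinear_eq_zero_of_diag _ (fun σ v => by simp [hM, hN]) fun v => by simp [hdiag]

end Polarization

/-! ### Continuous operations on observables and reduction to powers -/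

section Particles

variable {L A : Type*} [AddCommGroup L] [Module ℝ L]
  [NonAssocRing A] [StarRing A] [Module ℂ A] {P : PoissonBracket A} {S : StateSpace L A P}

@[simp] theorem StateSpace.primitive_apply {n : ℕ} (x : Fin n → A) (v : Fin n → L) :
    S.primitive x v = ∏ i, S.pair (v i) (x i) := by
  simp [StateSpace.primitive, StateSpace.lin]

namespace ParticleAlgebras

variable (E : ParticleAlgebras S)

@[simp] theorem tprod_apply {n : ℕ} (x : Fin n → A) (v : Fin n → L) :
    (E.tprod x : Form L n) v = ∏ i, S.pair (v i) (x i) :=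
  StateSpace.primitive_apply x v

variable {E} in
theorem obs_ext {n : ℕ} {X Y : E.obs n} (h : ∀ v, (X : Form L n) v = (Y : Form L n) v) : X = Y :=
  Subtype.ext (MultilinearMap.ext h)

variable {E} in
theorem IsSymm.ext {n : ℕ} {X Y : E.obs n} (hX : E.IsSymm X) (hY : E.IsSymm Y)
    (h : ∀ ρ, E.diag ρ X = E.diag ρ Y) : X = Y :=
  Subtype.ext (multilinear_ext_of_diag hX hY h)

@[simp] theorem diag_tprod {n : ℕ} (ρ : L) (x : Fin n → A) :
    E.diag ρ (E.tprod x) = ∏ i, S.pair ρ (x i) := by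
  simp [diag]

/-- Evaluation of all slots at the same state, as a continuous linear functional. -/
def diagL {n : ℕ} (ρ : L) : E.obs n →L[ℂ] ℂ where
  toFun := E.diag ρ
  map_add' _ _ := rfl
  map_smul' _ _ := rfl
  cont := E.eval_continuous _

@[simp] theorem diagL_apply {n : ℕ} (ρ : L) (W : E.obs n) : E.diagL ρ W = E.diag ρ W := rfl

/-- Evaluation of all slots at states, as a continuous linear functional. -/
def evalL {n : ℕ} (v : Fin n → L) : E.obs n →L[ℂ] ℂ where
  toFun W := (W : Form L n) v
  map_add' _ _ := rfl
  map_smul' _ _ := rfl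
  cont := E.eval_continuous v

@[simp] theorem evalL_apply {n : ℕ} (v : Fin n → L) (W : E.obs n) :
    E.evalL v W = (W : Form L n) v := rfl

/-- Evaluation of the first slot at a state, as a continuous linear map. -/
def sliceL (n : ℕ) (ρ : L) : E.obs (n + 1) →L[ℂ] E.obs n where
  toFun W := ⟨(W : Form L (n + 1)).curryLeft ρ, E.slice_mem ρ W⟩
  map_add' _ _ := rfl
  map_smul' _ _ := rfl
  cont := E.slice_continuous ρ

/-- Evaluation of the first `m` slots at a state, as a continuous linear map. -/
def contractL (ρ : L) {n : ℕ} : (m : ℕ) → E.obs (n + m) →L[ℂ] E.obs n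
  | 0 => ContinuousLinearMap.id ℂ _
  | m + 1 => (contractL ρ m).comp (E.sliceL (n + m) ρ)

@[simp] theorem contractL_apply (ρ : L) {n : ℕ} (m : ℕ) (W : E.obs (n + m)) :
    E.contractL ρ m W = E.contract ρ m W := by
  induction m with
  | zero => rfl
  | succ m ih => exact ih _

/-- `ampliate` as a continuous linear map. -/
def ampliateL {m n : ℕ} (f : Fin m ↪ Fin n) : E.obs m →L[ℂ] E.obs n where
  toFun := E.ampliate f
  map_add' X Y := Subtype.ext <| MultilinearMap.ext fun v => by
    simp [ampliate, StateSpace.ampliateForm, add_mul]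
  map_smul' c X := Subtype.ext <| MultilinearMap.ext fun v => by
    simp [ampliate, StateSpace.ampliateForm, mul_assoc]
  cont := E.ampliate_continuous f

/-- `symTensorOne` as a continuous linear map. -/
def symTensorOneL (m n : ℕ) : E.obs m →L[ℂ] E.obs n :=
  ((Fintype.card (Fin m ↪ Fin n) : ℂ))⁻¹ • ∑ f : Fin m ↪ Fin n, E.ampliateL f

@[simp] theorem symTensorOneL_apply {m : ℕ} (n : ℕ) (W : E.obs m) :
    E.symTensorOneL m n W = E.symTensorOne n W := by
  simp only [symTensorOneL, symTensorOne, smul_apply, sum_apply]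
  rfl

/-- The product with a fixed right factor. -/
def mulL {n : ℕ} (Y : E.obs n) : E.obs n →L[ℂ] E.obs n where
  toLinearMap := (E.mul n).flip Y
  cont := E.mul_continuous_left n Y

@[simp] theorem mulL_apply {n : ℕ} (X Y : E.obs n) : E.mulL Y X = E.mul n X Y := rfl

/-- The bracket with a fixed second argument. -/
def brL {n : ℕ} (Y : E.obs n) : E.obs n →L[ℂ] E.obs n where
  toLinearMap := (E.br n).flip Y
  cont := E.br_continuous_left n Y

@[simp] theorem brL_apply {n : ℕ} (X Y : E.obs n) : E.brL Y X = E.br n X Y := rfl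

/-- The bracket with a fixed first argument. -/
def brR {n : ℕ} (X : E.obs n) : E.obs n →L[ℂ] E.obs n where
  toLinearMap := E.br n X
  cont := E.br_continuous_right n X

@[simp] theorem brR_apply {n : ℕ} (X Y : E.obs n) : E.brR X Y = E.br n X Y := rfl

/-- `uniformize ε W n` as a continuous linear map of `W`. -/
def uniformizeL (ε : ℝ) (n : ℕ) : (∀ n, E.obs n) →L[ℂ] E.obs n :=
  ∑ m ∈ Finset.Icc 1 n, ((n.choose m : ℂ) * (ε : ℂ) ^ (m - 1)) •
    (E.symTensorOneL m n).comp (ContinuousLinearMap.proj m)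

@[simp] theorem uniformizeL_apply (ε : ℝ) (n : ℕ) (W : ∀ n, E.obs n) :
    E.uniformizeL ε n W = E.uniformize ε W n := by
  simp [uniformizeL, uniformize]

/-- `repForm ε X n` as a continuous linear map of `X`. -/
def repFormL (ε : ℝ) (n : ℕ) : (∀ n, E.obs n) →L[ℂ] E.obs n :=
  ∑ m ∈ Finset.range (n + 1),
    ((n.choose m : ℂ) * (-(1 / (ε : ℂ))) ^ (n - m) * (ε / (ε : ℂ) ^ m)) •
      (E.symTensorOneL m n).comp (ContinuousLinearMap.proj m)

@[simp] theorem repFormL_apply (ε : ℝ) (n : ℕ) (X : ∀ n, E.obs n) :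
    E.repFormL ε n X = E.repForm ε X n := by
  simp [repFormL, repForm]

/-- The power `x ⊗ ⋯ ⊗ x`. -/
def tpow (x : A) (n : ℕ) : E.obs n := E.tprod fun _ => x

@[simp] theorem diag_tpow (ρ : L) (x : A) (n : ℕ) : E.diag ρ (E.tpow x n) = S.pair ρ x ^ n := by
  simp [tpow]

theorem isSymm_tpow (x : A) (n : ℕ) : E.IsSymm (E.tpow x n) := fun σ v => by
  simp only [tpow, tprod_apply]
  exact Equiv.prod_comp σ fun i => S.pair (v i) x

theorem tpow_smul (c : ℂ) (x : A) (n : ℕ) : E.tpow (c • x) n = c ^ n • E.tpow x n :=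
  obs_ext fun v => by simp [tpow, Finset.prod_mul_distrib]

variable {E} in
theorem IsSymm.smul {n : ℕ} {X : E.obs n} (hX : E.IsSymm X) (c : ℂ) : E.IsSymm (c • X) :=
  fun σ v => by simp [hX σ v]

variable {E} in
theorem IsSymm.add {n : ℕ} {X Y : E.obs n} (hX : E.IsSymm X) (hY : E.IsSymm Y) :
    E.IsSymm (X + Y) := fun σ v => by simp [hX σ v, hY σ v]

theorem isSymm_zero (n : ℕ) : E.IsSymm (0 : E.obs n) := fun σ v => by simp

theorem isSymm_sum {n : ℕ} {ι : Type*} (s : Finset ι) (X : ι → E.obs n)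
    (hX : ∀ i ∈ s, E.IsSymm (X i)) : E.IsSymm (∑ i ∈ s, X i) := by
  classical
  induction s using Finset.induction_on with
  | empty => simpa using E.isSymm_zero n
  | insert i s hi ih =>
    rw [Finset.sum_insert hi]
    exact (hX i (by simp)).add (ih fun j hj => hX j (by simp [hj]))

theorem ampliate_apply {m n : ℕ} (f : Fin m ↪ Fin n) (W : E.obs m) (v : Fin n → L) :
    (E.ampliate f W : Form L n) v = (W : Form L m) (fun j => v (f j)) * S.onesFactor f v := rfl

theorem ampliate_perm {m n : ℕ} (f : Fin m ↪ Fin n) (W : E.obs m) (σ : Equiv.Perm (Fin n))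
    (v : Fin n → L) : (E.ampliate f W : Form L n) (fun i => v (σ i)) =
      (E.ampliate (f.trans σ.toEmbedding) W : Form L n) v := by
  classical
  simp only [ampliate_apply, Function.Embedding.trans_apply, Equiv.coe_toEmbedding]
  congr 1
  rw [StateSpace.onesFactor, StateSpace.onesFactor]
  conv_rhs => rw [← Equiv.prod_comp σ]
  refine Finset.prod_congr rfl fun i _ => ?_
  simp

theorem symTensorOne_apply {m n : ℕ} (W : E.obs m) (v : Fin n → L) :
    (E.symTensorOne n W : Form L n) v = ((Fintype.card (Fin m ↪ Fin n) : ℂ))⁻¹ *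
      ∑ f : Fin m ↪ Fin n, (E.ampliate f W : Form L n) v := by
  simp [symTensorOne]

/-- A permutation of the `n` slots only permutes the placements over which the average is taken. -/
theorem isSymm_symTensorOne {m : ℕ} (n : ℕ) (W : E.obs m) : E.IsSymm (E.symTensorOne n W) := by
  intro σ v
  simp only [symTensorOne_apply, ampliate_perm]
  congr 1
  exact Equiv.sum_comp (Equiv.embeddingCongr (Equiv.refl (Fin m)) σ)
    fun f => (E.ampliate f W : Form L n) v

/-- On the diagonal all placements give the same value. The condition `m ≤ n` ensures that a
placement exists, so the average is a genuine one. -/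
theorem diag_symTensorOne {m n : ℕ} (h : m ≤ n) (ρ : L) (W : E.obs m) :
    E.diag ρ (E.symTensorOne n W) = E.diag ρ W * S.pair ρ 1 ^ (n - m) := by
  classical
  have hones (f : Fin m ↪ Fin n) : S.onesFactor f (fun _ => ρ) = S.pair ρ 1 ^ (n - m) := by
    rw [StateSpace.onesFactor, Finset.prod_ite, Finset.prod_const_one, one_mul,
      Finset.prod_const]
    congr 1
    have : (Finset.univ.filter fun i => ¬ i ∈ Set.range f) = (Finset.univ.map f)ᶜ := by
      ext i; simp
    rw [this, Finset.card_compl]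
    simp
  have : Nonempty (Fin m ↪ Fin n) := ⟨Fin.castLEEmb h⟩
  have hc : (Fintype.card (Fin m ↪ Fin n) : ℂ) ≠ 0 := by
    exact_mod_cast Fintype.card_ne_zero
  simp only [diag, symTensorOne_apply, ampliate_apply, hones, Finset.sum_const, nsmul_eq_mul,
    Finset.card_univ]
  field_simp

variable {E} in
theorem IsSymm.symTensorOne_self {n : ℕ} {W : E.obs n} (hW : E.IsSymm W) :
    E.symTensorOne n W = W :=
  (E.isSymm_symTensorOne n W).ext hW fun ρ => by simp [E.diag_symTensorOne le_rfl]

/-- Continuous functionals on `A^{⊗n}` are determined on symmetric elements by their values on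
powers. -/
theorem functional_eq_zero_of_tpow {n : ℕ} (F : E.obs n →L[ℂ] ℂ) (h : ∀ x, F (E.tpow x n) = 0)
    {W : E.obs n} (hW : E.IsSymm W) : F W = 0 := by
  -- Here polarization is applied in the variables `x i ∈ A`, over `ℂ`; symmetrizing the primitive
  -- element makes `M` symmetric.
  let M : MultilinearMap ℂ (fun _ : Fin n => A) ℂ :=
    { toFun := fun x => F (E.symTensorOne n (E.tprod x))
      map_update_add' := by
        intro _ x i a b
        rw [← symTensorOneL_apply, ← symTensorOneL_apply, ← symTensorOneL_apply, ← map_add,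
          ← map_add]
        congr 2
        refine obs_ext fun v => ?_
        simp only [tprod_apply, Submodule.coe_add, add_apply]
        rw [← Finset.mul_prod_erase _ _ (Finset.mem_univ i),
          ← Finset.mul_prod_erase _ _ (Finset.mem_univ i),
          ← Finset.mul_prod_erase _ _ (Finset.mem_univ i)]
        have key (z : A) : ∏ j ∈ Finset.univ.erase i, S.pair (v j) (Function.update x i z j) =
            ∏ j ∈ Finset.univ.erase i, S.pair (v j) (x j) :=
          Finset.prod_congr rfl fun j hj => by rw [Function.update_of_ne (Finset.ne_of_mem_erase hj)]
        simp only [key, Function.update_self, map_add, add_mul]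
      map_update_smul' := by
        intro _ x i c b
        rw [← symTensorOneL_apply, ← symTensorOneL_apply, ← map_smul, ← map_smul]
        congr 2
        refine obs_ext fun v => ?_
        simp only [tprod_apply, Submodule.coe_smul, smul_apply]
        rw [← Finset.mul_prod_erase _ _ (Finset.mem_univ i),
          ← Finset.mul_prod_erase _ _ (Finset.mem_univ i)]
        have key (z : A) : ∏ j ∈ Finset.univ.erase i, S.pair (v j) (Function.update x i z j) =
            ∏ j ∈ Finset.univ.erase i, S.pair (v j) (x j) :=
          Finset.prod_congr rfl fun j hj => by rw [Function.update_of_ne (Finset.ne_of_mem_erase hj)]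
        simp only [key, Function.update_self, map_smul, smul_eq_mul, mul_assoc] }
  have hM : M = 0 := by
    refine multilinear_eq_zero_of_diag M (fun σ x => ?_) fun x => ?_
    · change F (E.symTensorOne n _) = F (E.symTensorOne n _)
      congr 1
      refine (E.isSymm_symTensorOne n _).ext (E.isSymm_symTensorOne n _) fun ρ => ?_
      simp only [E.diag_symTensorOne le_rfl, diag_tprod]
      rw [Equiv.prod_comp σ fun i => S.pair ρ (x i)]
    · change F (E.symTensorOne n (E.tpow x n)) = 0
      rw [(E.isSymm_tpow x n).symTensorOne_self, h]
  -- Vanishing on primitive elements extends to the dense span and then to its closure; a symmetric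
  -- `W` is its own symmetrization.
  have hF : ∀ X : E.obs n, F (E.symTensorOneL n n X) = 0 := by
    have : Set.EqOn (fun X => F (E.symTensorOneL n n X)) (fun _ => 0)
        (Submodule.span ℂ (Set.range fun x : Fin n → A => E.tprod x) : Set (E.obs n)) := by
      intro X hX
      induction hX using Submodule.span_induction with
      | mem X hX =>
        obtain ⟨x, rfl⟩ := hX
        change F (E.symTensorOneL n n _) = 0
        rw [symTensorOneL_apply]
        exact congrArg (fun M => M x) hM
      | zero => simp only [map_zero]
      | add X Y _ _ hX hY => simp only at hX hY ⊢; simp only [map_add, hX, hY, add_zero]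
      | smul c X _ hX => simp only at hX ⊢; simp only [map_smul, hX, smul_zero]
    exact congrFun (Continuous.ext_on (E.dense n)
      (F.continuous.comp (E.symTensorOneL n n).continuous) continuous_const this)
  have := hF W
  rwa [symTensorOneL_apply, hW.symTensorOne_self] at this

/-- Continuous functionals of families of symmetric elements are determined by their values on the
families of powers `n ↦ x ⊗ ⋯ ⊗ x`. -/
theorem family_ext (F G : (∀ n, E.obs n) →L[ℂ] ℂ) (h : ∀ x, F (E.tpow x) = G (E.tpow x))
    {c : ∀ n, E.obs n} (hc : ∀ n, E.IsSymm (c n)) : F c = G c := by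
  classical
  suffices ∀ F : (∀ n, E.obs n) →L[ℂ] ℂ, (∀ x, F (E.tpow x) = 0) → F c = 0 by
    have := this (F - G) fun x => by simp [h]
    simpa [sub_eq_zero] using this
  clear! F G
  intro F hF
  -- A continuous functional on a product depends on finitely many coordinates: a basic
  -- neighbourhood on which `|F| < 1` restricts only those in `I`, so it contains every multiple of
  -- a family vanishing on `I`, including the multiple on which `F` would be `1`.
  obtain ⟨I, hI⟩ : ∃ I : Finset ℕ, ∀ c : ∀ n, E.obs n, (∀ n ∈ I, c n = 0) → F c = 0 := by
    have hmem : F ⁻¹' Metric.ball 0 1 ∈ 𝓝 (0 : ∀ n, E.obs n) :=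
      F.continuous.continuousAt.preimage_mem_nhds (by simpa using Metric.ball_mem_nhds (0 : ℂ) one_pos)
    rw [nhds_pi, Filter.mem_pi] at hmem
    obtain ⟨I, hfin, t, ht, hsub⟩ := hmem
    refine ⟨hfin.toFinset, fun c hc0 => ?_⟩
    by_contra hne
    have := @hsub (((F c)⁻¹) • c) (fun n hn => by
      have : c n = 0 := hc0 n (by simpa using hn)
      simpa [this] using mem_of_mem_nhds (ht n))
    simp [hne] at this
  have hsum (c : ∀ n, E.obs n) : F c = ∑ n ∈ I, F (Pi.single n (c n)) := by
    rw [← map_sum, ← sub_eq_zero, ← map_sub]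
    refine hI _ fun n hn => ?_
    simp [Finset.sum_apply, Finset.sum_pi_single, hn]
  have hsingle (n : ℕ) (hn : n ∈ I) (x : A) : F (Pi.single n (E.tpow x n)) = 0 := by
    -- Replacing `x` by `s • x` scales degree `m` by `s ^ m`, so the hypothesis makes this
    -- polynomial vanish at every `s`, and the degrees separate.
    let p : Polynomial ℂ := ∑ m ∈ I, Polynomial.monomial m (F (Pi.single m (E.tpow x m)))
    have hp : p = 0 := by
      refine Polynomial.funext fun s => ?_
      have := hF (s • x)
      rw [hsum] at this
      simp only [p, Polynomial.eval_finsetSum, Polynomial.eval_monomial, Polynomial.eval_zero]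
      rw [← this]
      refine Finset.sum_congr rfl fun m _ => ?_
      rw [tpow_smul, Pi.single_smul, map_smul, smul_eq_mul, mul_comm]
    have := congrArg (fun p => p.coeff n) hp
    simpa [p, Polynomial.finsetSum_coeff, Polynomial.coeff_monomial, hn] using this
  rw [hsum]
  refine Finset.sum_eq_zero fun n hn => ?_
  exact E.functional_eq_zero_of_tpow
    (F.comp (ContinuousLinearMap.single ℂ (fun n => E.obs n) n))
    (fun x => by simpa using hsingle n hn x) (hc n)

end ParticleAlgebras

end Particles

section Particles

variable {L A : Type*} [AddCommGroup L] [Module ℝ L]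
  [NonAssocRing A] [StarRing A] [Module ℂ A] {P : PoissonBracket A} {S : StateSpace L A P}

/-- The Leibniz rule at `1 = 1 * 1` gives `{h, 1} = 2 {h, 1}`. -/
theorem PoissonBracket.br_one_right (P : PoissonBracket A) (h : A) : P.br h 1 = 0 := by
  have := P.leibniz h 1 1
  simpa using this

theorem PoissonBracket.br_one_left (P : PoissonBracket A) (h : A) : P.br 1 h = 0 := by
  rw [P.antisymm, P.br_one_right, neg_zero]

namespace ParticleAlgebras

variable (E : ParticleAlgebras S)

/-! ### Operations on powers -/

/-- Contraction consumes the first slots, exactly those selected by `i.val < m`; this matches the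
slots in which the symbol multiplies by `x`. -/
theorem contract_tprod_ite (ρ : L) (p q : A) {n : ℕ} (m : ℕ) :
    E.contract ρ m (E.tprod fun i : Fin (n + m) => if i.val < m then p else q) =
      S.pair ρ p ^ m • E.tpow q n := by
  induction m with
  | zero => simp [contract, tpow]
  | succ m ih =>
    have h : E.sliceL (n + m) ρ (E.tprod fun i : Fin (n + m + 1) => if i.val < m + 1 then p else q) =
        S.pair ρ p • E.tprod fun i : Fin (n + m) => if i.val < m then p else q := by
      refine obs_ext fun v => ?_
      change (E.tprod fun i : Fin (n + m + 1) => if i.val < m + 1 then p else q : Form L _)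
        (Fin.cons ρ v) = _
      simp [Fin.prod_univ_succ]
    change E.contract ρ m (E.sliceL (n + m) ρ _) = _
    erw [h]
    rw [← contractL_apply, map_smul, contractL_apply, ih, smul_smul, pow_succ']

@[simp] theorem contract_tpow (ρ : L) (x : A) {n : ℕ} (m : ℕ) :
    E.contract ρ m (E.tpow x (n + m)) = S.pair ρ x ^ m • E.tpow x n := by
  simpa [tpow] using E.contract_tprod_ite ρ x x (n := n) m

theorem mul_tpow_ite (x y : A) (k : ℕ) :
    E.mul (1 + k) (E.tpow x (1 + k)) (E.tprod fun i : Fin (1 + k) => if i.val < k then y else 1) =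
      E.tprod fun i : Fin (1 + k) => if i.val < k then x * y else x := by
  refine (E.mul_primitive _ _).trans ?_
  change E.tprod _ = _
  congr 1
  funext i
  split_ifs <;> simp

/-- The `n` summands of the bracket, one per slot, coincide on the diagonal. The truncated exponent
at `n = 0` is harmless because of the factor `n`. -/
theorem diag_br_tpow (ρ : L) (x y : A) (n : ℕ) :
    E.diag ρ (E.br n (E.tpow x n) (E.tpow y n)) =
      n * S.pair ρ (x * y) ^ (n - 1) * S.pair ρ (P.br x y) := by
  have : E.br n (E.tpow x n) (E.tpow y n) = ∑ j : Fin n,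
      E.tprod (Function.update (fun _ => x * y) j (P.br x y)) := E.br_primitive _ _
  rw [this, ← diagL_apply, map_sum]
  have h (j : Fin n) : E.diagL ρ (E.tprod (Function.update (fun _ => x * y) j (P.br x y))) =
      S.pair ρ (x * y) ^ (n - 1) * S.pair ρ (P.br x y) := by
    rw [diagL_apply, diag_tprod, ← Finset.mul_prod_erase _ _ (Finset.mem_univ j),
      Finset.prod_congr rfl fun i hi => by
        rw [Function.update_of_ne (Finset.ne_of_mem_erase hi)]]
    simp [mul_comm]
  simp only [h, Finset.sum_const, Finset.card_univ, Fintype.card_fin, nsmul_eq_mul, mul_assoc]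

theorem br_tpow_one (x y : A) : E.br 1 (E.tpow x 1) (E.tpow y 1) = E.tpow (P.br x y) 1 := by
  have : E.br 1 (E.tpow x 1) (E.tpow y 1) = ∑ j : Fin 1,
      E.tprod (Function.update (fun _ => x * y) j (P.br x y)) := E.br_primitive _ _
  rw [this]
  refine obs_ext fun v => ?_
  simp [tpow]

variable {E} in
-- Contracting a power gives a multiple of a power, which is symmetric; permuting the remaining
-- slots is then compared by a continuous functional that vanishes on powers.
theorem IsSymm.contract {n : ℕ} (ρ : L) (m : ℕ) {X : E.obs (n + m)} (hX : E.IsSymm X) :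
    E.IsSymm (E.contract ρ m X) := by
  intro σ v
  have := E.functional_eq_zero_of_tpow
    ((E.evalL (fun i => v (σ i)) - E.evalL v).comp (E.contractL ρ m)) (fun x => by
      have := E.isSymm_tpow x n σ v
      simp [this]) hX
  simpa [sub_eq_zero] using this

theorem contract_smul_state (r : ℝ) (ρ : L) {n : ℕ} (m : ℕ) {X : E.obs (n + m)}
    (hX : E.IsSymm X) : E.contract (r • ρ) m X = (r : ℂ) ^ m • E.contract ρ m X := by
  refine obs_ext fun v => ?_
  have := E.functional_eq_zero_of_tpow
    ((E.evalL v).comp (E.contractL (r • ρ) m - (r : ℂ) ^ m • E.contractL ρ m)) (fun x => by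
      simp [mul_pow, mul_assoc]) hX
  simpa [sub_eq_zero] using this

theorem diag_smul (ρ : L) {n : ℕ} (c : ℂ) (X : E.obs n) :
    E.diag ρ (c • X) = c * E.diag ρ X := rfl

theorem diag_smul_state (r : ℝ) (ρ : L) {n : ℕ} (X : E.obs n) :
    E.diag (r • ρ) X = (r : ℂ) ^ n * E.diag ρ X := by
  have := (X : Form L n).map_smul_univ (fun _ => r) (fun _ => ρ)
  simpa [diag] using this

/-! ### The symbol and its quantization -/

/-- For powers of `w` this is the binomial theorem for `(⟨ρ, w⟩ + ε⟨ρ, w * x⟩) ^ n`, times the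
uncontracted factor `w`. -/
theorem sum_symbolHamiltonian [IsScalarTower ℂ A A] [SMulCommClass ℂ A A]
    {W : ∀ n, E.obs n} (hW : ∀ n, E.IsSymm (W n)) (ε : ℝ) (ρ : L) (x : A) (n : ℕ) :
    ∑ p ∈ Finset.HasAntidiagonal.antidiagonal n, (ε : ℂ) ^ p.1 • E.symbolHamiltonian W p.1 p.2 ρ x =
      (1 / (n ! : ℂ)) • E.contract ρ n (E.mul (1 + n) (W (1 + n))
        (E.tprod fun i : Fin (1 + n) => if i.val < n then 1 + (ε : ℂ) • x else 1)) := by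
  refine obs_ext fun v => ?_
  have := E.family_ext
    (∑ p ∈ Finset.HasAntidiagonal.antidiagonal n, ((ε : ℂ) ^ p.1 * (1 / ((p.1 ! : ℂ) * p.2 !))) •
      (E.evalL v).comp ((E.contractL ρ p.1).comp ((E.mulL
        (E.tprod fun i : Fin (1 + p.1) => if i.val < p.1 then x else 1)).comp
          ((E.contractL ρ p.2).comp (ContinuousLinearMap.proj (1 + p.1 + p.2))))))
    ((1 / (n ! : ℂ)) • (E.evalL v).comp ((E.contractL ρ n).comp ((E.mulL
        (E.tprod fun i : Fin (1 + n) => if i.val < n then 1 + (ε : ℂ) • x else 1)).comp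
          (ContinuousLinearMap.proj (1 + n))))) (fun w => ?_) hW
  · simpa [symbolHamiltonian, mul_assoc] using this
  · simp only [sum_apply, smul_apply, ContinuousLinearMap.comp_apply, ContinuousLinearMap.proj_apply,
      contractL_apply, contract_tpow, map_smul, mulL_apply, mul_tpow_ite, contract_tprod_ite,
      evalL_apply, smul_eq_mul, mul_add, mul_one, map_add]
    rw [add_comm (S.pair ρ w), (Commute.all _ _).add_pow']
    simp only [mul_smul_comm, map_smul, smul_eq_mul, Finset.sum_mul, Finset.mul_sum]
    refine Finset.sum_congr rfl fun p hp => ?_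
    obtain rfl := Finset.HasAntidiagonal.mem_antidiagonal.mp hp
    have h : ((p.1 + p.2).choose p.1 : ℂ) = (p.1 + p.2)! / (p.1 ! * p.2 !) := by
      rw [Nat.cast_add_choose]
    have h0 : ((p.1 + p.2)! : ℂ) ≠ 0 := by exact_mod_cast Nat.factorial_ne_zero _
    rw [nsmul_eq_mul, h, mul_pow]
    field_simp

/-- The quantized term of index `(k, a)` of the symbol, without its factor `εᵏ`: the functional
`Y ↦ ⟨ρ^{⊗(1+k)}, {⟨ρ^{⊗a}, W^{(1+k+a)}⟩, Y}⟩ / ((1+k)! a!)`. -/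
def quantumSymbol (W : ∀ n, E.obs n) (k a : ℕ) (ρ : L) : E.obs (1 + k) →L[ℂ] ℂ :=
  (1 / (((1 + k)! : ℂ) * a !)) • (E.diagL ρ).comp (E.brR (E.contract ρ a (W (1 + k + a))))

theorem quantumSymbol_apply (W : ∀ n, E.obs n) (k a : ℕ) (ρ : L) (Y : E.obs (1 + k)) :
    E.quantumSymbol W k a ρ Y = 1 / (((1 + k)! : ℂ) * a !) *
      E.diag ρ (E.br (1 + k) (E.contract ρ a (W (1 + k + a))) Y) := rfl

theorem quantumSymbol_tpow {W : ∀ n, E.obs n} (hW : ∀ n, E.IsSymm (W n)) (k a : ℕ) (ρ : L) (x : A) :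
    E.quantumSymbol W k a ρ (E.tpow x (1 + k)) = E.symbol W k a ρ x := by
  have := E.family_ext
    ((1 / (((1 + k)! : ℂ) * a !)) • (E.diagL ρ).comp ((E.brL (E.tpow x (1 + k))).comp
      ((E.contractL ρ a).comp (ContinuousLinearMap.proj (1 + k + a)))))
    ((1 / ((k ! : ℂ) * a !)) • (E.diagL ρ).comp ((E.brL (E.tpow x 1)).comp
      ((E.contractL ρ k).comp ((E.mulL
        (E.tprod fun i : Fin (1 + k) => if i.val < k then x else 1)).comp
          ((E.contractL ρ a).comp (ContinuousLinearMap.proj (1 + k + a))))))) (fun w => ?_) hW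
  · simpa [quantumSymbol_apply, symbol, symbolHamiltonian, tpow, diag_smul] using this
  · simp only [smul_apply, ContinuousLinearMap.comp_apply, ContinuousLinearMap.proj_apply,
      contractL_apply, contract_tpow, map_smul, mulL_apply, mul_tpow_ite, contract_tprod_ite,
      brL_apply, diagL_apply, diag_br_tpow, smul_eq_mul, br_tpow_one, diag_tpow]
    -- The bracket of `(1 + k)`-fold powers yields a factor `1 + k`, which turns the `1/(1+k)!` of
    -- the quantization into the `1/k!` of the symbol.
    have hk : ((1 + k : ℕ) : ℂ) ≠ 0 := by exact_mod_cast (by omega : 1 + k ≠ 0)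
    rw [Nat.add_comm 1 k] at hk ⊢
    rw [Nat.factorial_succ]
    push_cast at hk ⊢
    field_simp

variable {J : Set ℝ} {W : ℝ → ∀ n, E.obs n}

theorem quantizes_quantumSymbol (hW : ∀ t ∈ J, ∀ n, E.IsSymm (W t n)) :
    E.Quantizes J W fun k a t ρ => E.quantumSymbol (W t) k a ρ :=
  fun k a t ht ρ x => E.quantumSymbol_tpow (hW t ht) k a ρ x

variable {E} in
/-- All quantizations agree on symmetric elements. -/
theorem Quantizes.apply_eq (hW : ∀ t ∈ J, ∀ n, E.IsSymm (W t n))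
    {g : ∀ k : ℕ, ℕ → ℝ → L → (E.obs (1 + k) →L[ℂ] ℂ)} (hg : E.Quantizes J W g) (k a : ℕ) {t : ℝ}
    (ht : t ∈ J) (ρ : L) {Y : E.obs (1 + k)} (hY : E.IsSymm Y) :
    g k a t ρ Y = E.quantumSymbol (W t) k a ρ Y := by
  have := E.functional_eq_zero_of_tpow (g k a t ρ - E.quantumSymbol (W t) k a ρ) (fun x => by
    rw [sub_apply, E.quantumSymbol_tpow (hW t ht), sub_eq_zero]
    exact hg k a t ht ρ x) hY
  rwa [sub_apply, sub_eq_zero] at this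

variable {E} in
-- The operator only feeds contractions of symmetric coefficients to the quantization, and on
-- symmetric elements every quantization agrees with `quantumSymbol`. Hence nothing below depends on
-- the choice of `g`.
theorem Quantizes.opTerm_eq (hW : ∀ t ∈ J, ∀ n, E.IsSymm (W t n))
    {g : ∀ k : ℕ, ℕ → ℝ → L → (E.obs (1 + k) →L[ℂ] ℂ)} (hg : E.Quantizes J W g) {t : ℝ}
    (ht : t ∈ J) (ε : ℝ) {c : ∀ n, E.obs n} (hc : ∀ n, E.IsSymm (c n)) (ρ : L) (p : ℕ × ℕ × ℕ) :
    E.opTerm ε g t c ρ p = (ε : ℂ) ^ p.1 / ((1 + p.1)! * p.2.1 ! * p.2.2 !) *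
      E.diag ρ (E.br (1 + p.1) (E.contract ρ p.2.1 (W t (1 + p.1 + p.2.1)))
        (E.contract ρ p.2.2 (c (1 + p.1 + p.2.2)))) := by
  rw [opTerm, hg.apply_eq hW _ _ ht _ ((hc _).contract _ _), quantumSymbol_apply]
  have h1 : ((1 + p.1)! : ℂ) ≠ 0 := by exact_mod_cast Nat.factorial_ne_zero _
  have h2 : (p.2.1 ! : ℂ) ≠ 0 := by exact_mod_cast Nat.factorial_ne_zero _
  have h3 : (p.2.2 ! : ℂ) ≠ 0 := by exact_mod_cast Nat.factorial_ne_zero _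
  field_simp

variable {E} in
theorem Quantizes.opTerm_smul_state (hW : ∀ t ∈ J, ∀ n, E.IsSymm (W t n))
    {g : ∀ k : ℕ, ℕ → ℝ → L → (E.obs (1 + k) →L[ℂ] ℂ)} (hg : E.Quantizes J W g) {t : ℝ}
    (ht : t ∈ J) (ε : ℝ) {c : ∀ n, E.obs n} (hc : ∀ n, E.IsSymm (c n)) (r : ℝ) (ρ : L)
    (p : ℕ × ℕ × ℕ) : E.opTerm ε g t c (r • ρ) p =
      (r : ℂ) ^ (1 + p.1 + p.2.1 + p.2.2) * E.opTerm ε g t c ρ p := by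
  rw [hg.opTerm_eq hW ht ε hc, hg.opTerm_eq hW ht ε hc, diag_smul_state,
    E.contract_smul_state r ρ _ (hW t ht _), E.contract_smul_state r ρ _ (hc _)]
  rw [← brR_apply, map_smul, brR_apply, ← brL_apply, map_smul, ← diagL_apply, map_smul, map_smul]
  simp only [smul_eq_mul, diagL_apply, brL_apply, pow_add]
  ring

end ParticleAlgebras

end Particles

section Particles

variable {L A : Type*} [AddCommGroup L] [Module ℝ L]
  [NonAssocRing A] [StarRing A] [Module ℂ A] {P : PoissonBracket A} {S : StateSpace L A P}

namespace ParticleAlgebras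

variable (E : ParticleAlgebras S)

/-! ### Uniformization and representing functionals of powers -/

theorem sum_symTensorOne_tpow (a b : ℂ) (z : A) (n : ℕ) :
    ∑ m ∈ Finset.range (n + 1), ((n.choose m : ℂ) * a ^ (n - m) * b ^ m) •
      E.symTensorOne n (E.tpow z m) = E.tpow (a • (1 : A) + b • z) n := by
  refine (E.isSymm_sum _ _ fun _ _ => (E.isSymm_symTensorOne n _).smul _).ext
    (E.isSymm_tpow _ n) fun ρ => ?_
  rw [diag_tpow, ← diagL_apply, map_sum, map_add, map_smul, map_smul, smul_eq_mul, smul_eq_mul,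
    add_comm (_ * _), add_pow]
  refine Finset.sum_congr rfl fun m hm => ?_
  rw [diagL_apply, diag_smul, E.diag_symTensorOne (Nat.lt_succ_iff.mp (Finset.mem_range.mp hm)),
    diag_tpow, mul_pow, mul_pow]
  ring

/-- The binomial expansion of `(1 + εw)^{⊗n}`, divided by `ε`; the sum starts at `m = 1`, which
accounts for the subtracted power of the identity. -/
theorem uniformize_tpow {ε : ℝ} (hε : ε ≠ 0) (w : A) (n : ℕ) :
    E.uniformize ε (E.tpow w) n =
      (ε : ℂ)⁻¹ • (E.tpow ((1 : A) + (ε : ℂ) • w) n - E.tpow 1 n) := by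
  have hε' : (ε : ℂ) ≠ 0 := by exact_mod_cast hε
  have h := E.sum_symTensorOne_tpow 1 ε w n
  have h0 : E.symTensorOne n (E.tpow w 0) = E.tpow 1 n :=
    (E.isSymm_symTensorOne n _).ext (E.isSymm_tpow _ n) fun ρ => by
      rw [E.diag_symTensorOne (Nat.zero_le n)]; simp
  rw [Finset.range_eq_Ico, Finset.sum_eq_sum_Ico_succ_bot (Nat.succ_pos n), h0] at h
  simp only [one_smul] at h
  rw [← h, uniformize]
  simp only [Nat.choose_zero_right, Nat.cast_one, one_pow, pow_zero, mul_one, one_smul,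
    add_sub_cancel_left, Finset.smul_sum, smul_smul]
  refine Finset.sum_congr ?_ fun m hm => ?_
  · ext m; simp
  · obtain ⟨m, rfl⟩ : ∃ m', m = m' + 1 := ⟨m - 1, by simp at hm; omega⟩
    congr 1
    rw [pow_succ, Nat.add_sub_cancel]
    field_simp

/-- In terms of functionals: `exp(-⟨ρ, 1⟩/ε) · ε exp(⟨ρ, z⟩/ε) = ε exp(⟨ρ, (z - 1)/ε⟩)`. -/
theorem repForm_tpow (ε : ℝ) (z : A) (n : ℕ) :
    E.repForm ε (E.tpow z) n = (ε : ℂ) • E.tpow ((ε : ℂ)⁻¹ • (z - 1)) n := by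
  have h := E.sum_symTensorOne_tpow (-(1 / (ε : ℂ))) (ε : ℂ)⁻¹ z n
  rw [show (ε : ℂ)⁻¹ • (z - 1) = (-(1 / (ε : ℂ))) • (1 : A) + (ε : ℂ)⁻¹ • z by
    rw [smul_sub, one_div, neg_smul]; abel, ← h, repForm, Finset.smul_sum]
  refine Finset.sum_congr rfl fun m _ => ?_
  rw [smul_smul]
  congr 1
  rw [inv_pow]
  ring

theorem isSymm_repForm (ε : ℝ) (X : ∀ n, E.obs n) (n : ℕ) : E.IsSymm (E.repForm ε X n) :=
  E.isSymm_sum _ _ fun _ _ => (E.isSymm_symTensorOne n _).smul _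

theorem diag_repForm (ε : ℝ) (X : ∀ n, E.obs n) (ρ : L) (n : ℕ) :
    E.diag ρ (E.repForm ε X n) = ∑ m ∈ Finset.range (n + 1),
      ((n.choose m : ℂ) * (-(S.pair ρ 1 / ε)) ^ (n - m) * (ε / (ε : ℂ) ^ m)) * E.diag ρ (X m) := by
  rw [repForm, ← diagL_apply, map_sum]
  refine Finset.sum_congr rfl fun m hm => ?_
  rw [diagL_apply, diag_smul, E.diag_symTensorOne (Nat.lt_succ_iff.mp (Finset.mem_range.mp hm)),
    show -(S.pair ρ 1 / ε) = -(1 / (ε : ℂ)) * S.pair ρ 1 by ring, mul_pow]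
  ring

/-- The trinomial theorem, divided by a factorial, over the index triples of fixed degree. -/
theorem sum_degreeIndices (x y z : ℂ) (d : ℕ) :
    ∑ p ∈ degreeIndices (d + 1), x ^ p.1 / p.1 ! * (y ^ p.2.1 / p.2.1 !) * (z ^ p.2.2 / p.2.2 !) =
      (x + y + z) ^ d / d ! := by
  have add_pow_div (x y : ℂ) (n : ℕ) : (x + y) ^ n / n ! =
      ∑ p ∈ Finset.HasAntidiagonal.antidiagonal n, x ^ p.1 / p.1 ! * (y ^ p.2 / p.2 !) := by
    rw [(Commute.all _ _).add_pow', Finset.sum_div]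
    refine Finset.sum_congr rfl fun p hp => ?_
    obtain rfl := Finset.HasAntidiagonal.mem_antidiagonal.mp hp
    have h0 : ((p.1 + p.2)! : ℂ) ≠ 0 := by exact_mod_cast Nat.factorial_ne_zero _
    rw [nsmul_eq_mul, Nat.cast_add_choose]
    field_simp
  rw [add_assoc, add_pow_div]
  simp_rw [add_pow_div y z, Finset.mul_sum]
  rw [Finset.sum_sigma']
  refine Finset.sum_bij' (fun p _ => ⟨(p.1, p.2.1 + p.2.2), (p.2.1, p.2.2)⟩)
    (fun q _ => (q.1.1, q.2.1, q.2.2)) ?_ ?_ ?_ ?_ ?_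
  · intro p hp
    simp only [degreeIndices, Finset.mem_filter] at hp
    simp only [Finset.mem_sigma, Finset.HasAntidiagonal.mem_antidiagonal, and_true]
    omega
  · rintro ⟨⟨a, b⟩, c, e⟩ hq
    simp only [Finset.mem_sigma, Finset.HasAntidiagonal.mem_antidiagonal] at hq
    simp only [degreeIndices, Finset.mem_filter, Finset.mem_product, Finset.mem_range]
    omega
  · intro p _; rfl
  · rintro ⟨⟨a, b⟩, c, e⟩ hq
    simp only [Finset.mem_sigma, Finset.HasAntidiagonal.mem_antidiagonal] at hq
    obtain ⟨_, rfl⟩ := hq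
    rfl
  · intro p _
    simp only [mul_assoc]

/-- The component of degree `d` of the right side of the pseudodifferential equation, in terms of
the right sides of the Heisenberg equations. -/
theorem opComponent_repForm [IsScalarTower ℂ A A] [SMulCommClass ℂ A A]
    {J : Set ℝ} {W : ℝ → ∀ n, E.obs n} (hW : ∀ t ∈ J, ∀ n, E.IsSymm (W t n))
    {g : ∀ k : ℕ, ℕ → ℝ → L → (E.obs (1 + k) →L[ℂ] ℂ)} (hg : E.Quantizes J W g) {t : ℝ}
    (ht : t ∈ J) {ε : ℝ} (hε : ε ≠ 0) {X : ∀ n, E.obs n} (hX : ∀ n, E.IsSymm (X n)) (ρ : L)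
    (d : ℕ) : d ! * E.opComponent ε g t (E.repForm ε X) ρ d = ∑ m ∈ Finset.range (d + 1),
      ((d.choose m : ℂ) * (-(S.pair ρ 1 / ε)) ^ (d - m) * (ε / (ε : ℂ) ^ m)) *
        E.diag ρ (E.br m (E.uniformize ε (W t) m) (X m)) := by
  have hε' : (ε : ℂ) ≠ 0 := by exact_mod_cast hε
  simp only [opComponent, hg.opTerm_eq hW ht ε (E.isSymm_repForm ε X)]
  have hWt := hW t ht
  generalize W t = V at hWt
  -- Reduction of `X` to powers of `z`; then, with `z` fixed, `h2` reduces the Hamiltonian family to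
  -- powers of `w`.
  have h1 := E.family_ext
    ((d ! : ℂ) • ∑ p ∈ degreeIndices d, ((ε : ℂ) ^ p.1 / ((1 + p.1)! * p.2.1 ! * p.2.2 !)) •
      (E.diagL ρ).comp ((E.brR (E.contract ρ p.2.1 (V (1 + p.1 + p.2.1)))).comp
        ((E.contractL ρ p.2.2).comp (E.repFormL ε (1 + p.1 + p.2.2)))))
    (∑ m ∈ Finset.range (d + 1),
      ((d.choose m : ℂ) * (-(S.pair ρ 1 / ε)) ^ (d - m) * (ε / (ε : ℂ) ^ m)) •
      (E.diagL ρ).comp ((E.brR (E.uniformize ε V m)).comp (ContinuousLinearMap.proj m)))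
    (fun z => ?_) hX
  · simpa using h1
  clear hX X
  have h2 := E.family_ext
    ((d ! : ℂ) • ∑ p ∈ degreeIndices d, ((ε : ℂ) ^ p.1 / ((1 + p.1)! * p.2.1 ! * p.2.2 !)) •
      (E.diagL ρ).comp ((E.brL (E.contract ρ p.2.2
        (E.repForm ε (E.tpow z) (1 + p.1 + p.2.2)))).comp
          ((E.contractL ρ p.2.1).comp (ContinuousLinearMap.proj (1 + p.1 + p.2.1)))))
    (∑ m ∈ Finset.range (d + 1),
      ((d.choose m : ℂ) * (-(S.pair ρ 1 / ε)) ^ (d - m) * (ε / (ε : ℂ) ^ m)) •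
      (E.diagL ρ).comp ((E.brL (E.tpow z m)).comp (E.uniformizeL ε m)))
    (fun w => ?_) hWt
  · simpa using h2
  clear hWt V
  set κ := S.pair ρ (P.br w z) with hκ
  set e := S.pair ρ 1 with he
  set y := (ε : ℂ)⁻¹ • (z - 1) with hy
  have hwy : S.pair ρ (w * y) = (S.pair ρ (w * z) - S.pair ρ w) / ε := by
    rw [hy, mul_smul_comm, mul_sub, mul_one, map_smul, map_sub, smul_eq_mul]
    ring
  have hbr : S.pair ρ (P.br w y) = κ / ε := by
    rw [hy, map_smul, map_sub, P.br_one_right, sub_zero, map_smul, smul_eq_mul]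
    ring
  have hyy : S.pair ρ y = (S.pair ρ z - e) / ε := by
    rw [hy, map_smul, map_sub, smul_eq_mul]
    ring
  -- The identity part of the uniformization has zero bracket, and `{1 + εw, z} = ε{w, z}` cancels
  -- the factor `1/ε`.
  have hR (m : ℕ) : E.diag ρ (E.br m (E.uniformize ε (E.tpow w) m) (E.tpow z m)) =
      m * (S.pair ρ z + ε * S.pair ρ (w * z)) ^ (m - 1) * κ := by
    rw [E.uniformize_tpow hε, ← brL_apply, map_smul, map_sub, diag_smul, ← diagL_apply, map_sub,
      diagL_apply, diagL_apply, brL_apply, brL_apply, diag_br_tpow, diag_br_tpow, map_add,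
      P.br_one_left, map_smul, LinearMap.add_apply, P.br_one_left, LinearMap.smul_apply, add_mul,
      smul_mul_assoc, one_mul]
    simp only [map_add, map_smul, map_zero, smul_eq_mul, zero_add, mul_zero, sub_zero]
    rw [← hκ]
    field_simp
  clear_value y
  have hL (p : ℕ × ℕ × ℕ) : E.diag ρ (E.br (1 + p.1)
      (E.contract ρ p.2.1 (E.tpow w (1 + p.1 + p.2.1)))
      (E.contract ρ p.2.2 (E.repForm ε (E.tpow z) (1 + p.1 + p.2.2)))) =
      (S.pair ρ w) ^ p.2.1 * (S.pair ρ y) ^ p.2.2 * ((1 + p.1 : ℕ) * S.pair ρ (w * y) ^ p.1 * κ) := by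
    rw [E.repForm_tpow, ← hy, ← contractL_apply _ _ _ (_ • _), map_smul, contractL_apply,
      contract_tpow, contract_tpow, ← brR_apply, map_smul, map_smul, brR_apply, ← brL_apply,
      map_smul, brL_apply, diag_smul, diag_smul, diag_smul, diag_br_tpow, hbr, Nat.add_sub_cancel_left]
    field_simp
  simp only [sum_apply, smul_apply, ContinuousLinearMap.comp_apply, ContinuousLinearMap.proj_apply,
    contractL_apply, diagL_apply, brL_apply, uniformizeL_apply, hR, hL, smul_eq_mul]
  -- In degree `0` there are no index triples, and on the right only `m = 0` occurs, which its
  -- factor `m` kills.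
  rcases d with _ | d
  · simp [degreeIndices]
  have hsum := sum_degreeIndices (ε * S.pair ρ (w * y)) (S.pair ρ w) (S.pair ρ y) d
  have hlhs : ∑ p ∈ degreeIndices (d + 1), (ε : ℂ) ^ p.1 / ((1 + p.1)! * p.2.1 ! * p.2.2 !) *
      ((S.pair ρ w) ^ p.2.1 * (S.pair ρ y) ^ p.2.2 *
        ((1 + p.1 : ℕ) * S.pair ρ (w * y) ^ p.1 * κ)) =
      κ * ((ε * S.pair ρ (w * y) + S.pair ρ w + S.pair ρ y) ^ d / d !) := by
    rw [← hsum, Finset.mul_sum]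
    refine Finset.sum_congr rfl fun p _ => ?_
    have hk : ((p.1 + 1 : ℕ) : ℂ) ≠ 0 := by exact_mod_cast Nat.succ_ne_zero p.1
    rw [Nat.add_comm 1 p.1, Nat.factorial_succ, mul_pow]
    push_cast at hk ⊢
    field_simp
  -- The heart of the equivalence: substituting `y = (z - 1)/ε` cancels `⟨ρ, w⟩` and leaves the
  -- Heisenberg base together with the exponent of the prefactor.
  have hbase : ε * S.pair ρ (w * y) + S.pair ρ w + S.pair ρ y =
      (S.pair ρ z + ε * S.pair ρ (w * z)) / ε + -(e / ε) := by
    rw [hwy, hyy]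
    field_simp
    ring
  rw [hlhs, hbase, add_pow, Nat.factorial_succ]
  conv_rhs => rw [Finset.sum_range_succ']
  have hd : (d ! : ℂ) ≠ 0 := by exact_mod_cast Nat.factorial_ne_zero _
  simp only [Nat.cast_zero, zero_mul, mul_zero, add_zero]
  push_cast
  rw [show ((d : ℂ) + 1) * d ! * (κ * ((∑ m ∈ Finset.range (d + 1),
      ((S.pair ρ z + ε * S.pair ρ (w * z)) / ε) ^ m * (-(e / ε)) ^ (d - m) * (d.choose m)) / d !)) =
      ((d : ℂ) + 1) * κ * ∑ m ∈ Finset.range (d + 1),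
        ((S.pair ρ z + ε * S.pair ρ (w * z)) / ε) ^ m * (-(e / ε)) ^ (d - m) * (d.choose m) by
    field_simp, Finset.mul_sum]
  refine Finset.sum_congr rfl fun m _ => ?_
  -- The factor `m + 1` produced by the bracket is absorbed into the binomial coefficient.
  have hch : ((d + 1).choose (m + 1) : ℂ) * (m + 1) = (d + 1) * d.choose m := by
    exact_mod_cast (Nat.add_one_mul_choose_eq d m).symm
  have hpow : (ε : ℂ) / (ε : ℂ) ^ (m + 1) = 1 / (ε : ℂ) ^ m := by
    rw [pow_succ]
    field_simp
  rw [div_pow, hpow]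
  linear_combination (-(S.pair ρ z + ε * S.pair ρ (w * z)) ^ m * (-(e / ε)) ^ (d - m) * κ /
    (ε : ℂ) ^ m) * hch

end ParticleAlgebras

end Particles

/-! ### Differentiation of triangular systems and of power series -/

section Analysis

/-- The matrix `K` is constant in time and lower triangular with nonzero diagonal, so `x n` is
recovered from `y n` and the earlier `x m` by finite sums. -/
theorem hasDerivAt_triangular_iff {x y : ℕ → ℝ → ℂ} {X Y : ℕ → ℂ} {K : ℕ → ℕ → ℂ} {t : ℝ}
    (hK : ∀ n, K n n ≠ 0) (hy : ∀ n τ, y n τ = ∑ m ∈ Finset.range (n + 1), K n m * x m τ)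
    (hY : ∀ n, Y n = ∑ m ∈ Finset.range (n + 1), K n m * X m) :
    (∀ n, HasDerivAt (x n) (X n) t) ↔ ∀ n, HasDerivAt (y n) (Y n) t := by
  constructor
  · intro h n
    rw [show y n = fun τ => ∑ m ∈ Finset.range (n + 1), K n m * x m τ from funext (hy n), hY]
    exact HasDerivAt.fun_sum fun m _ => (h m).const_mul _
  · intro h n
    induction n using Nat.strong_induction_on with
    | _ n ih =>
      have hx : x n = fun τ => (K n n)⁻¹ * (y n τ - ∑ m ∈ Finset.range n, K n m * x m τ) := by
        funext τ
        rw [hy, Finset.sum_range_succ, add_sub_cancel_left, inv_mul_cancel_left₀ (hK n)]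
      have hX : X n = (K n n)⁻¹ * (Y n - ∑ m ∈ Finset.range n, K n m * X m) := by
        rw [hY, Finset.sum_range_succ, add_sub_cancel_left, inv_mul_cancel_left₀ (hK n)]
      rw [hx, hX]
      exact ((h n).sub (HasDerivAt.fun_sum fun m hm =>
        (ih m (Finset.mem_range.mp hm)).const_mul _)).const_mul _

/-- The difference equals `r` times a tail of the series. The bound depends on `b` only through its
majorant `u`, which gives uniformity in parameters. -/
theorem norm_powerSeries_remainder_le {b : ℕ → ℂ} {u : ℕ → ℝ} (hu : Summable u)
    (hb : ∀ n, ‖b n‖ ≤ u n) {r : ℝ} (hr : r ≠ 0)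
    (hr1 : |r| ≤ 1) (n : ℕ) :
    ‖(∑' k, (r : ℂ) ^ k * b k - ∑ k ∈ Finset.range n, (r : ℂ) ^ k * b k) / (r : ℂ) ^ n - b n‖ ≤
      |r| * ∑' k, u k := by
  have hu0 (k : ℕ) : 0 ≤ u k := (norm_nonneg _).trans (hb k)
  have hr0 : (r : ℂ) ≠ 0 := by exact_mod_cast hr
  have hpow (k : ℕ) : ‖(r : ℂ) ^ k‖ ≤ 1 := by
    rw [norm_pow, Complex.norm_real, Real.norm_eq_abs]
    exact pow_le_one₀ (abs_nonneg r) hr1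
  have hle (k : ℕ) : ‖(r : ℂ) ^ k * b k‖ ≤ u k := by
    rw [norm_mul]
    exact (mul_le_of_le_one_left (norm_nonneg _) (hpow k)).trans (hb k)
  have hs : Summable fun k => (r : ℂ) ^ k * b k := Summable.of_norm_bounded hu hle
  have hsplit := hs.sum_add_tsum_nat_add (n + 1)
  rw [Finset.sum_range_succ] at hsplit
  have hshift : ∑' k, (r : ℂ) ^ (k + (n + 1)) * b (k + (n + 1)) =
      (r : ℂ) ^ n * (r * ∑' k, (r : ℂ) ^ k * b (k + (n + 1))) := by
    rw [← tsum_mul_left, ← tsum_mul_left]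
    refine tsum_congr fun k => ?_
    ring
  have hrem : (∑' k, (r : ℂ) ^ k * b k - ∑ k ∈ Finset.range n, (r : ℂ) ^ k * b k) / (r : ℂ) ^ n -
      b n = r * ∑' k, (r : ℂ) ^ k * b (k + (n + 1)) := by
    rw [← hsplit, hshift]
    field_simp
    ring
  rw [hrem, norm_mul, Complex.norm_real, Real.norm_eq_abs]
  refine mul_le_mul_of_nonneg_left ?_ (abs_nonneg r)
  have hu' : Summable fun k => u (k + (n + 1)) := (summable_nat_add_iff (n + 1)).mpr hu
  calc ‖∑' k, (r : ℂ) ^ k * b (k + (n + 1))‖ ≤ ∑' k, u (k + (n + 1)) :=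
        tsum_of_norm_bounded hu'.hasSum fun k => by
          rw [norm_mul]
          exact (mul_le_of_le_one_left (norm_nonneg _) (hpow k)).trans (hb _)
    _ ≤ ∑' k, u k := by
        rw [← hu.sum_add_tsum_nat_add (n + 1)]
        exact le_add_of_nonneg_left (Finset.sum_nonneg fun k _ => hu0 k)

/-- For power series in `r ∈ (0, 1]` whose coefficients depend on a parameter `t` and, together with
the would-be derivatives, are dominated locally uniformly in `t`, differentiability in `t` of the
coefficients is equivalent to differentiability of the sums. -/
theorem hasDerivAt_coeff_iff_hasDerivAt_powerSeries {J : Set ℝ} (hJ : IsOpen J) {a o : ℕ → ℝ → ℂ}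
    (ha : ∀ t₀ ∈ J, ∃ u : ℕ → ℝ, Summable u ∧ ∀ᶠ t in 𝓝 t₀, ∀ n, ‖a n t‖ ≤ u n)
    (ho : ∀ t₀ ∈ J, ∃ u : ℕ → ℝ, Summable u ∧ ∀ᶠ t in 𝓝 t₀, ∀ n, ‖o n t‖ ≤ u n) :
    (∀ n, ∀ t ∈ J, HasDerivAt (a n) (o n t) t) ↔ ∀ r ∈ Set.Ioc (0 : ℝ) 1, ∀ t ∈ J,
      HasDerivAt (fun τ => ∑' n, (r : ℂ) ^ n * a n τ) (∑' n, (r : ℂ) ^ n * o n t) t := by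
  have hball : ∀ t ∈ J, ∃ δ > 0, ∃ u v : ℕ → ℝ, Summable u ∧ Summable v ∧
      ∀ τ ∈ Metric.ball t δ, τ ∈ J ∧ (∀ n, ‖a n τ‖ ≤ u n) ∧ ∀ n, ‖o n τ‖ ≤ v n := by
    intro t ht
    obtain ⟨u, hu, hau⟩ := ha t ht
    obtain ⟨v, hv, hov⟩ := ho t ht
    obtain ⟨δ, hδ, hsub⟩ := Metric.eventually_nhds_iff_ball.mp
      ((hJ.eventually_mem ht).and (hau.and hov))
    exact ⟨δ, hδ, u, v, hu, hv, hsub⟩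
  constructor
  · intro h r hr t ht
    obtain ⟨δ, hδ, u, v, hu, hv, hB⟩ := hball t ht
    have htB : t ∈ Metric.ball t δ := Metric.mem_ball_self hδ
    have hle (k : ℕ) (z : ℂ) : ‖(r : ℂ) ^ k * z‖ ≤ ‖z‖ := by
      rw [norm_mul, norm_pow, Complex.norm_real, Real.norm_of_nonneg hr.1.le]
      exact mul_le_of_le_one_left (norm_nonneg _) (pow_le_one₀ hr.1.le hr.2)
    -- For `r ≤ 1` the majorants of the coefficients also dominate the series, so it may be
    -- differentiated term by term.
    exact hasDerivAt_tsum_of_isPreconnected hv Metric.isOpen_ball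
      (convex_ball t δ).isPreconnected (fun n τ hτ => (h n τ (hB τ hτ).1).const_mul _)
      (fun n τ hτ => (hle _ _).trans ((hB τ hτ).2.2 n)) htB
      (Summable.of_norm_bounded hu fun n => (hle _ _).trans ((hB t htB).2.1 n)) htB
  · intro h n
    induction n using Nat.strong_induction_on with
    | _ n ih =>
      intro t ht
      obtain ⟨δ, hδ, u, v, hu, hv, hB⟩ := hball t ht
      have hlim (U : ℝ) : ∀ e > 0, ∀ᶠ r in 𝓝[>] (0 : ℝ), r * U < e := by
        intro e he
        have : Filter.Tendsto (fun r : ℝ => r * U) (𝓝[>] 0) (𝓝 (0 * U)) :=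
          (Filter.tendsto_id.mono_left nhdsWithin_le_nhds).mul_const U
        rw [zero_mul] at this
        exact this.eventually_lt_const he
      have hIoc : ∀ᶠ r in 𝓝[>] (0 : ℝ), r ∈ Set.Ioc (0 : ℝ) 1 :=
        Ioc_mem_nhdsGT one_pos
      -- The `n`-th coefficient is the limit as `r → 0⁺` of the remainder after `n` terms divided by
      -- `r ^ n`. These quotients are differentiable by hypothesis and induction, and their
      -- derivatives converge uniformly to `o n`.
      refine hasDerivAt_of_tendstoUniformlyOn (l := 𝓝[>] (0 : ℝ)) (s := Metric.ball t δ)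
        (f := fun r τ => (∑' k, (r : ℂ) ^ k * a k τ -
          ∑ k ∈ Finset.range n, (r : ℂ) ^ k * a k τ) / (r : ℂ) ^ n)
        (f' := fun r τ => (∑' k, (r : ℂ) ^ k * o k τ -
          ∑ k ∈ Finset.range n, (r : ℂ) ^ k * o k τ) / (r : ℂ) ^ n)
        (g' := o n) Metric.isOpen_ball ?_ ?_ ?_ (Metric.mem_ball_self hδ)
      · rw [Metric.tendstoUniformlyOn_iff]
        intro e he
        filter_upwards [hIoc, hlim (∑' k, v k) e he] with r hr hre τ hτ
        rw [dist_comm, dist_eq_norm]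
        exact (norm_powerSeries_remainder_le hv (hB τ hτ).2.2 hr.1.ne' (abs_le.mpr ⟨by linarith [hr.1], hr.2⟩) n).trans_lt
          (by rwa [abs_of_pos hr.1])
      · filter_upwards [hIoc] with r hr τ hτ
        have hτJ := (hB τ hτ).1
        exact ((h r hr τ hτJ).sub (HasDerivAt.fun_sum fun k hk =>
          (ih k (Finset.mem_range.mp hk) τ hτJ).const_mul _)).div_const _
      · intro τ hτ
        rw [Metric.tendsto_nhds]
        intro e he
        filter_upwards [hIoc, hlim (∑' k, u k) e he] with r hr hre
        rw [dist_eq_norm]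
        exact (norm_powerSeries_remainder_le hu (hB τ hτ).2.1 hr.1.ne' (abs_le.mpr ⟨by linarith [hr.1], hr.2⟩) n).trans_lt
          (by rwa [abs_of_pos hr.1])

theorem hasSum_sum_fibers {β γ V : Type*} [NormedAddCommGroup V] [CompleteSpace V] {f : β → V}
    (hf : Summable f) {g : β → γ} {s : γ → Finset β} (hs : ∀ b c, b ∈ s c ↔ g b = c) :
    HasSum (fun c => ∑ b ∈ s c, f b) (∑' b, f b) := by
  have h := hf.hasSum.tsum_fiberwise g
  have heq (c : γ) : g ⁻¹' {c} = (s c : Set β) := by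
    ext b
    simp [hs]
  have hfun (c : γ) := (tsum_congr_set_coe f (heq c)).trans (Finset.tsum_subtype' _ f)
  simpa only [hfun] using h

end Analysis

/-! ### Equivalence of the Heisenberg and pseudodifferential equations -/

section Particles

variable {L A : Type*} [AddCommGroup L] [Module ℝ L]
  [NonAssocRing A] [StarRing A] [Module ℂ A] {P : PoissonBracket A} {S : StateSpace L A P}

namespace ParticleAlgebras

variable (E : ParticleAlgebras S)

theorem mem_degreeIndices {p : ℕ × ℕ × ℕ} {d : ℕ} :
    p ∈ degreeIndices d ↔ 1 + p.1 + p.2.1 + p.2.2 = d := by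
  simp only [degreeIndices, Finset.mem_filter, Finset.mem_product, Finset.mem_range]
  omega

theorem hasSum_degreeIndices {V : Type*} [NormedAddCommGroup V] [CompleteSpace V]
    {f : ℕ × ℕ × ℕ → V} (hf : Summable f) :
    HasSum (fun d => ∑ p ∈ degreeIndices d, f p) (∑' p, f p) :=
  hasSum_sum_fibers hf fun _ _ => mem_degreeIndices

/-- The Heisenberg equations are equivalent to the pseudodifferential equation between homogeneous
components. -/
theorem heisenberg_iff_formalEquation [IsScalarTower ℂ A A] [SMulCommClass ℂ A A]
    {J : Set ℝ} {W : ℝ → ∀ n, E.obs n} (hW : ∀ t ∈ J, ∀ n, E.IsSymm (W t n))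
    {g : ∀ k : ℕ, ℕ → ℝ → L → (E.obs (1 + k) →L[ℂ] ℂ)} (hg : E.Quantizes J W g)
    {ε : ℝ} (hε : ε ≠ 0) {X : ℝ → ∀ n, E.obs n} (hX : ∀ t ∈ J, ∀ n, E.IsSymm (X t n)) :
    E.Heisenberg ε J W X ↔ E.FormalEquation ε J g fun t => E.repForm ε (X t) := by
  have hε' : (ε : ℂ) ≠ 0 := by exact_mod_cast hε
  have hfac (n : ℕ) : (n ! : ℂ) ≠ 0 := by exact_mod_cast Nat.factorial_ne_zero n
  have key (t : ℝ) (ht : t ∈ J) (ρ : L) := hasDerivAt_triangular_iff (t := t)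
    (x := fun n τ => E.diag ρ (X τ n))
    (X := fun n => E.diag ρ (E.br n (E.uniformize ε (W t) n) (X t n)))
    (y := fun d τ => E.diag ρ (E.repForm ε (X τ) d) / d !)
    (Y := fun d => E.opComponent ε g t (E.repForm ε (X t)) ρ d)
    (K := fun d m =>
      (d.choose m : ℂ) * (-(S.pair ρ 1 / ε)) ^ (d - m) * (ε / (ε : ℂ) ^ m) / d !)
    (fun n => by simp [hε', hfac])
    (fun n τ => by
      rw [diag_repForm, Finset.sum_div]
      exact Finset.sum_congr rfl fun m _ => by ring)
    (fun n => by
      have := E.opComponent_repForm hW hg ht hε (hX t ht) ρ n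
      rw [← mul_right_inj' (hfac n), this, Finset.mul_sum]
      refine Finset.sum_congr rfl fun m _ => ?_
      have := hfac n
      field_simp)
  exact ⟨fun h d t ht ρ => (key t ht ρ).mp (fun n => h n t ht ρ) d,
    fun h n t ht ρ => (key t ht ρ).mpr (fun d => h d t ht ρ) n⟩

theorem diag_repForm_div_factorial (ε : ℝ) (X : ∀ n, E.obs n) (ρ : L) (n : ℕ) :
    E.diag ρ (E.repForm ε X n) / n ! = ∑ p ∈ Finset.HasAntidiagonal.antidiagonal n,
      (-(S.pair ρ 1 / ε)) ^ p.1 / p.1 ! * E.repTerm ε X ρ p.2 := by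
  have hfac (n : ℕ) : (n ! : ℂ) ≠ 0 := by exact_mod_cast Nat.factorial_ne_zero n
  rw [diag_repForm, Finset.sum_div, ← Finset.Nat.sum_antidiagonal_swap,
    Finset.Nat.sum_antidiagonal_eq_sum_range_succ_mk]
  refine Finset.sum_congr rfl fun m hm => ?_
  have hmn : m ≤ n := Nat.lt_succ_iff.mp (Finset.mem_range.mp hm)
  simp only [Prod.swap, repTerm, Nat.cast_choose ℂ hmn]
  have := hfac n
  have := hfac m
  have := hfac (n - m)
  rw [← div_div (ε : ℂ)]
  field_simp

theorem representing_eq_tsum {ε : ℝ} {X : ∀ n, E.obs n} {ρ : L}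
    (h : Summable fun n => ‖E.repTerm ε X ρ n‖) :
    E.representing ε X ρ = ∑' n, E.diag ρ (E.repForm ε X n) / n ! := by
  simp only [diag_repForm_div_factorial]
  rw [representing, Complex.exp_eq_exp_ℂ, NormedSpace.exp_eq_tsum_div]
  exact tsum_mul_tsum_eq_tsum_sum_antidiagonal_of_summable_norm
    (NormedSpace.norm_expSeries_div_summable _) h

variable {E} in
-- The exponential prefactor does not depend on `t`, so its Cauchy product with the majorant of the
-- representing series is again a summable majorant.
theorem IsRegular.exists_bound_repForm {ε : ℝ} {J : Set ℝ}
    {g : ∀ k : ℕ, ℕ → ℝ → L → (E.obs (1 + k) →L[ℂ] ℂ)} {X : ℝ → ∀ n, E.obs n}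
    (h : E.IsRegular ε J g X) {t₀ : ℝ} (ht₀ : t₀ ∈ J) (ρ : L) : ∃ u : ℕ → ℝ, Summable u ∧
      ∀ᶠ t in 𝓝 t₀, ∀ n, ‖E.diag ρ (E.repForm ε (X t) n) / (n ! : ℂ)‖ ≤ u n := by
  obtain ⟨u, hu, hle⟩ := h.rep t₀ ht₀ ρ
  have hu0 (n : ℕ) : 0 ≤ u n := (norm_nonneg _).trans (hle.self_of_nhds n)
  have hu' : Summable fun n => ‖u n‖ := by simpa only [Real.norm_of_nonneg (hu0 _)] using hu
  refine ⟨fun n => ∑ p ∈ Finset.HasAntidiagonal.antidiagonal n,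
    ‖S.pair ρ 1 / ε‖ ^ p.1 / p.1 ! * u p.2, ?_, ?_⟩
  · have := summable_norm_sum_mul_antidiagonal_of_summable_norm
      (NormedSpace.norm_expSeries_div_summable ‖S.pair ρ 1 / ε‖) hu'
    exact this.of_norm
  · filter_upwards [hle] with t ht n
    rw [diag_repForm_div_factorial]
    refine norm_sum_le_of_le _ fun p _ => ?_
    rw [norm_mul, norm_div, norm_pow, norm_neg, Complex.norm_natCast]
    gcongr
    exact ht _

variable {E} in
theorem IsRegular.exists_bound_opComponent {ε : ℝ} {J : Set ℝ}
    {g : ∀ k : ℕ, ℕ → ℝ → L → (E.obs (1 + k) →L[ℂ] ℂ)} {X : ℝ → ∀ n, E.obs n}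
    (h : E.IsRegular ε J g X) {t₀ : ℝ} (ht₀ : t₀ ∈ J) (ρ : L) : ∃ u : ℕ → ℝ, Summable u ∧
      ∀ᶠ t in 𝓝 t₀, ∀ n, ‖E.opComponent ε g t (E.repForm ε (X t)) ρ n‖ ≤ u n := by
  obtain ⟨u, hu, hle⟩ := h.op t₀ ht₀ ρ
  refine ⟨fun d => ∑ p ∈ degreeIndices d, u p, (hasSum_degreeIndices hu).summable, ?_⟩
  filter_upwards [hle] with t ht d
  exact norm_sum_le_of_le _ fun p _ => ht p

/-- The Heisenberg equations are equivalent to the pseudodifferential equation between values. -/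
theorem heisenberg_iff_hasDerivAt_representing [IsScalarTower ℂ A A] [SMulCommClass ℂ A A]
    {J : Set ℝ} (hJ : IsOpen J) {W : ℝ → ∀ n, E.obs n} (hW : ∀ t ∈ J, ∀ n, E.IsSymm (W t n))
    {g : ∀ k : ℕ, ℕ → ℝ → L → (E.obs (1 + k) →L[ℂ] ℂ)} (hg : E.Quantizes J W g)
    {ε : ℝ} (hε : ε ≠ 0) {X : ℝ → ∀ n, E.obs n} (hX : ∀ t ∈ J, ∀ n, E.IsSymm (X t n))
    (hreg : E.IsRegular ε J g X) :
    E.Heisenberg ε J W X ↔ ∀ t ∈ J, ∀ ρ : L,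
      HasDerivAt (fun τ => E.representing ε (X τ) ρ) (E.op ε g t (E.repForm ε (X t)) ρ) t := by
  rw [E.heisenberg_iff_formalEquation hW hg hε hX]
  have key (ρ : L) := hasDerivAt_coeff_iff_hasDerivAt_powerSeries hJ
    (a := fun n τ => E.diag ρ (E.repForm ε (X τ) n) / n !)
    (o := fun n τ => E.opComponent ε g τ (E.repForm ε (X τ)) ρ n)
    (fun t₀ ht₀ => hreg.exists_bound_repForm ht₀ ρ)
    (fun t₀ ht₀ => hreg.exists_bound_opComponent ht₀ ρ)
  have hrep (r : ℝ) (ρ : L) (t : ℝ) (ht : t ∈ J) : E.representing ε (X t) (r • ρ) =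
      ∑' n, (r : ℂ) ^ n * (E.diag ρ (E.repForm ε (X t) n) / n !) := by
    obtain ⟨u, hu, hle⟩ := hreg.rep t ht (r • ρ)
    rw [E.representing_eq_tsum (Summable.of_nonneg_of_le (fun _ => norm_nonneg _)
      hle.self_of_nhds hu)]
    simp only [diag_smul_state, mul_div_assoc]
  have hop (r : ℝ) (ρ : L) (t : ℝ) (ht : t ∈ J) : E.op ε g t (E.repForm ε (X t)) (r • ρ) =
      ∑' n, (r : ℂ) ^ n * E.opComponent ε g t (E.repForm ε (X t)) ρ n := by
    obtain ⟨u, hu, hle⟩ := hreg.op t ht (r • ρ)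
    have hs : Summable (E.opTerm ε g t (E.repForm ε (X t)) (r • ρ)) :=
      Summable.of_norm_bounded hu hle.self_of_nhds
    rw [op, ← (hasSum_degreeIndices hs).tsum_eq]
    refine tsum_congr fun d => ?_
    rw [opComponent, Finset.mul_sum]
    refine Finset.sum_congr rfl fun p hp => ?_
    rw [hg.opTerm_smul_state hW ht ε (E.isSymm_repForm ε (X t)), mem_degreeIndices.mp hp]
  -- Along the ray `r • ρ` the homogeneous components are the coefficients in `r`. The power series
  -- agrees with the functional for times in `J`, a neighbourhood of `t`.
  have hiff (r : ℝ) (ρ : L) (t : ℝ) (ht : t ∈ J) :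
      HasDerivAt (fun τ => E.representing ε (X τ) (r • ρ))
        (E.op ε g t (E.repForm ε (X t)) (r • ρ)) t ↔
      HasDerivAt (fun τ => ∑' n, (r : ℂ) ^ n * (E.diag ρ (E.repForm ε (X τ) n) / n !))
        (∑' n, (r : ℂ) ^ n * E.opComponent ε g t (E.repForm ε (X t)) ρ n) t := by
    rw [hop r ρ t ht]
    exact Filter.EventuallyEq.hasDerivAt_iff <| by
      filter_upwards [hJ.mem_nhds ht] with τ hτ using hrep r ρ τ hτ
  constructor
  · intro h t ht ρ
    have := (hiff 1 ρ t ht).mpr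
      ((key ρ).mp (fun n t ht => h n t ht ρ) 1 ⟨one_pos, le_rfl⟩ t ht)
    simpa only [one_smul] using this
  · intro h d t ht ρ
    exact (key ρ).mpr (fun r _ t ht => (hiff r ρ t ht).mp (h t ht _)) d t ht

end ParticleAlgebras

end Particles

section Particles

variable {L A : Type*} [AddCommGroup L] [Module ℝ L]
  [NonAssocRing A] [StarRing A] [Module ℂ A] {P : PoissonBracket A} {S : StateSpace L A P}

namespace ParticleAlgebras

variable (E : ParticleAlgebras S)

/-! ### Derivatives of entire functionals -/

theorem exists_eq_tpow (X : E.obs 1) : ∃ x : A, X = E.tpow x 1 := by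
  obtain ⟨x, hx⟩ := E.obs_one X
  exact ⟨x, Subtype.ext hx⟩

/-- On powers of `x` this is the binomial theorem for `(⟨ρ, x⟩ + s⟨σ, x⟩) ^ n`. -/
theorem diag_add_smul_state {c : ∀ n, E.obs n} (hc : ∀ n, E.IsSymm (c n)) (ρ σ : L) (s : ℝ)
    (n : ℕ) : E.diag (ρ + s • σ) (c n) / n ! = ∑ p ∈ Finset.HasAntidiagonal.antidiagonal n,
      (s : ℂ) ^ p.2 * (E.diag ρ (E.contract σ p.2 (c (p.1 + p.2))) / (p.1 ! * p.2 !)) := by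
  have := E.family_ext
    ((1 / (n ! : ℂ)) • (E.diagL (ρ + s • σ)).comp (ContinuousLinearMap.proj n))
    (∑ p ∈ Finset.HasAntidiagonal.antidiagonal n, ((s : ℂ) ^ p.2 / (p.1 ! * p.2 !)) •
      (E.diagL ρ).comp ((E.contractL σ p.2).comp (ContinuousLinearMap.proj (p.1 + p.2))))
    (fun x => ?_) hc
  · simp only [sum_apply, smul_apply, ContinuousLinearMap.comp_apply,
      ContinuousLinearMap.proj_apply, contractL_apply, diagL_apply, smul_eq_mul] at this
    rw [div_eq_mul_one_div, mul_comm, this]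
    exact Finset.sum_congr rfl fun p _ => by ring
  · simp only [sum_apply, smul_apply, ContinuousLinearMap.comp_apply,
      ContinuousLinearMap.proj_apply, contractL_apply, diagL_apply, smul_eq_mul, contract_tpow,
      diag_tpow, map_add, map_smul, LinearMap.add_apply, LinearMap.smul_apply,
      Complex.real_smul]
    rw [(Commute.all _ _).add_pow', Finset.mul_sum]
    refine Finset.sum_congr rfl fun p hp => ?_
    obtain rfl := Finset.HasAntidiagonal.mem_antidiagonal.mp hp
    have h0 : ((p.1 + p.2)! : ℂ) ≠ 0 := by exact_mod_cast Nat.factorial_ne_zero _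
    rw [nsmul_eq_mul, Nat.cast_add_choose, mul_pow]
    field_simp

theorem diag_contract_one {c : ∀ n, E.obs n} (hc : ∀ n, E.IsSymm (c n)) (ρ σ : L) (p : ℕ) :
    E.diag ρ (E.contract σ 1 (c (p + 1))) = E.diag σ (E.contract ρ p (c (1 + p))) := by
  have := E.family_ext
    ((E.diagL ρ).comp ((E.contractL σ 1).comp (ContinuousLinearMap.proj (p + 1))))
    ((E.diagL σ).comp ((E.contractL ρ p).comp (ContinuousLinearMap.proj (1 + p))))
    (fun x => ?_) hc
  · simpa using this
  · simp [mul_comm]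

variable {E} in
theorem IsEntire.summable_diag {c : ∀ n, E.obs n} (hc : E.IsEntire c) (ρ : L) :
    Summable fun n => E.diag ρ (c n) / (n ! : ℂ) := by
  have hinj : Function.Injective fun n : ℕ => (n, 0) := fun m n h => by simpa using h
  have := (hc ρ 0).comp_injective hinj
  refine Summable.of_norm (this.congr fun n => ?_)
  simp [contract]

variable {E} in
theorem IsEntire.summable_contract {c : ∀ n, E.obs n} (hent : E.IsEntire c)
    (hc : ∀ n, E.IsSymm (c n)) (ρ σ : L) :
    Summable fun p => E.diag σ (E.contract ρ p (c (1 + p))) / (p ! : ℂ) := by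
  have hinj : Function.Injective fun n : ℕ => (n, 1) := fun m n h => by simpa using h
  have := (hent ρ σ).comp_injective hinj
  refine Summable.of_norm (this.congr fun n => ?_)
  simp [E.diag_contract_one hc]

variable {E} in
-- Absolute convergence of the double Taylor series lets it be regrouped as a power series in `s`,
-- whose linear coefficient is the derivative.
theorem IsEntire.hasLineDerivAt {c : ∀ n, E.obs n} (hent : E.IsEntire c)
    (hc : ∀ n, E.IsSymm (c n)) (ρ σ : L) :
    HasLineDerivAt ℝ (E.toFunctional c)
      (∑' p, E.diag σ (E.contract ρ p (c (1 + p))) / (p ! : ℂ)) ρ σ := by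
  set T : ℕ × ℕ → ℂ := fun p =>
    E.diag ρ (E.contract σ p.2 (c (p.1 + p.2))) / (p.1 ! * p.2 !) with hT
  have hTs : Summable fun p => ‖T p‖ := by
    refine (hent ρ σ).congr fun p => ?_
    simp [hT]
  have hB : Summable fun q => ∑' p, ‖T (p, q)‖ := hTs.prod_symm.prod
  have hBq (q : ℕ) : Summable fun p => ‖T (p, q)‖ := hTs.prod_symm.prod_factor q
  have hle (q : ℕ) : ‖∑' p, T (p, q)‖ ≤ ∑' p, ‖T (p, q)‖ := norm_tsum_le_tsum_norm (hBq q)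
  have hf (s : ℝ) (hs : |s| ≤ 1) :
      E.toFunctional c (ρ + s • σ) = ∑' q, (s : ℂ) ^ q * ∑' p, T (p, q) := by
    have hsT : Summable fun p : ℕ × ℕ => (s : ℂ) ^ p.2 * T p := by
      refine Summable.of_norm_bounded hTs fun p => ?_
      rw [norm_mul, norm_pow, Complex.norm_real, Real.norm_eq_abs]
      exact mul_le_of_le_one_left (norm_nonneg _) (pow_le_one₀ (abs_nonneg s) hs)
    simp only [toFunctional, E.diag_add_smul_state hc]
    have h1 := (hasSum_sum_fibers hsT (g := fun p => p.1 + p.2)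
      (s := Finset.HasAntidiagonal.antidiagonal)
      fun _ _ => Finset.HasAntidiagonal.mem_antidiagonal).tsum_eq
    have h2 := ((Equiv.prodComm ℕ ℕ).tsum_eq (fun p : ℕ × ℕ => (s : ℂ) ^ p.2 * T p)).symm.trans
      hsT.prod_symm.tsum_prod
    rw [h1, h2]
    simp only [Prod.swap, tsum_mul_left]
  have hS : HasDerivAt (fun s : ℝ => E.toFunctional c (ρ + s • σ)) (∑' p, T (p, 1)) 0 := by
    rw [hasDerivAt_iff_tendsto_slope, tendsto_iff_norm_sub_tendsto_zero]
    have hlim : Filter.Tendsto (fun s : ℝ => |s| * ∑' q, ∑' p, ‖T (p, q)‖) (𝓝[≠] 0) (𝓝 0) := by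
      have : Continuous fun s : ℝ => |s| * ∑' q, ∑' p, ‖T (p, q)‖ := by fun_prop
      have := this.tendsto 0
      rw [abs_zero, zero_mul] at this
      exact this.mono_left nhdsWithin_le_nhds
    refine squeeze_zero' (Filter.Eventually.of_forall fun _ => norm_nonneg _) ?_ hlim
    have h1 : ∀ᶠ s in 𝓝[≠] (0 : ℝ), |s| ≤ 1 := by
      have : ∀ᶠ s in 𝓝 (0 : ℝ), |s| < 1 := by
        filter_upwards [Metric.ball_mem_nhds (0 : ℝ) one_pos] with s hs
        simpa using hs
      exact (this.filter_mono nhdsWithin_le_nhds).mono fun s hs => hs.le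
    filter_upwards [h1, self_mem_nhdsWithin] with s hs hs0
    have := norm_powerSeries_remainder_le hB hle hs0 hs 1
    have h0 := hf 0 (by simp)
    rw [tsum_eq_single 0 (fun q hq => by simp [hq])] at h0
    rw [slope_def_module, hf s hs, h0]
    simpa [div_eq_inv_mul] using this
  have hD : ∑' p, T (p, 1) = ∑' p, E.diag σ (E.contract ρ p (c (1 + p))) / (p ! : ℂ) :=
    tsum_congr fun p => by simp [hT, E.diag_contract_one hc]
  rw [← hD]
  exact hS

variable {E} {J : Set ℝ} {W : ℝ → ∀ n, E.obs n} {H : ℝ → L → A}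

/-- The given derivative and the termwise one agree by uniqueness; the degree-zero term, absent from
the Hamilton functional, is constant in `ρ`. -/
theorem IsHamiltonFunctional.pair_eq_tsum (hW : E.IsHamiltonFunctional J W H) {t : ℝ} (ht : t ∈ J)
    (ρ σ : L) : S.pair σ (H t ρ) =
      ∑' a, E.diag σ (E.contract ρ a (W t (1 + a))) / (a ! : ℂ) := by
  have h1 := (hW.entire t ht).hasLineDerivAt (hW.symm t ht) ρ σ
  have h2 (ρ : L) : E.toFunctional (W t) ρ =
      E.diag (0 : L) (W t 0) + E.hamiltonFunctional (W t) ρ := by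
    rw [toFunctional, ((hW.entire t ht).summable_diag ρ).tsum_eq_zero_add, hamiltonFunctional,
      Nat.factorial_zero, Nat.cast_one, div_one]
    congr 1
    exact congrArg (W t 0 : Form L 0) (Subsingleton.elim _ _)
  have h3 := hW.deriv t ht ρ σ
  refine HasDerivAt.unique (h3 : HasDerivAt _ _ _) ?_
  have h4 : HasDerivAt (fun s : ℝ => E.toFunctional (W t) (ρ + s • σ) - E.diag (0 : L) (W t 0))
    _ 0 := HasDerivAt.sub_const _ h1
  simpa only [h2, add_sub_cancel_left] using h4

theorem IsHamiltonFunctional.star_eq (hW : E.IsHamiltonFunctional J W H) {t : ℝ} (ht : t ∈ J)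
    (ρ : L) : star (H t ρ) = H t ρ := by
  rw [← sub_eq_zero]
  refine S.separating _ fun σ => ?_
  rw [map_sub, S.pair_star, sub_eq_zero, Complex.conj_eq_iff_im]
  have h : HasDerivAt (fun s : ℝ => E.hamiltonFunctional (W t) (ρ + s • σ)) _ 0 :=
    hW.deriv t ht ρ σ
  have h1 := Complex.imCLM.hasFDerivAt.comp_hasDerivAt (0 : ℝ) h
  have h2 : (Complex.imCLM ∘ fun s : ℝ => E.hamiltonFunctional (W t) (ρ + s • σ)) =
      fun _ => 0 := funext fun s => hW.real t ht _
  rw [h2] at h1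
  exact (h1.unique (hasDerivAt_const _ _))

/-- The series for `H(t, ρ)` converges only when paired with states. For self-adjoint `y`, `⟨ρ, {h,
y}⟩ = -⟨{ρ, y}, h⟩`, so convergence at the state `{ρ, y}` suffices; a general `x` splits into real
and imaginary parts. -/
theorem IsHamiltonFunctional.hasSum_pair_br [StarModule ℂ A] (hW : E.IsHamiltonFunctional J W H)
    {t : ℝ} (ht : t ∈ J) (ρ : L) {w : ℕ → A}
    (hw : ∀ a, E.contract ρ a (W t (1 + a)) = E.tpow (w a) 1) (x : A) :
    HasSum (fun a => S.pair ρ (P.br (w a) x) / (a ! : ℂ)) (S.pair ρ (P.br (H t ρ) x)) := by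
  have hsa (y : A) (hy : star y = y) :
      HasSum (fun a => S.pair ρ (P.br (w a) y) / (a ! : ℂ)) (S.pair ρ (P.br (H t ρ) y)) := by
    have h1 := ((hW.entire t ht).summable_contract (hW.symm t ht) ρ (S.poisson ρ y)).hasSum.neg
    rw [← hW.pair_eq_tsum ht, S.poisson_spec ρ y hy, ← map_neg, ← P.antisymm] at h1
    refine (congrArg (fun f => HasSum f _) (funext fun a => ?_)).mp h1
    rw [hw, diag_tpow, pow_one, S.poisson_spec ρ y hy, P.antisymm y, map_neg]
    ring
  have h1 := (hsa _ (realPart x).2.star_eq).add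
    ((hsa _ (imaginaryPart x).2.star_eq).mul_left Complex.I)
  have hx (z : A) : S.pair ρ (P.br z x) = S.pair ρ (P.br z (realPart x)) +
      Complex.I * S.pair ρ (P.br z (imaginaryPart x)) := by
    rw [← smul_eq_mul, ← map_smul, ← map_smul, ← map_add, ← map_add,
      realPart_add_I_smul_imaginaryPart]
  rw [hx]
  convert h1 using 1
  funext a
  rw [hx]
  ring

/-! ### The limit `ε → 0` -/

variable {g : ∀ k : ℕ, ℕ → ℝ → L → (E.obs (1 + k) →L[ℂ] ℂ)}

theorem tendsto_opTerm (g : ∀ k : ℕ, ℕ → ℝ → L → (E.obs (1 + k) →L[ℂ] ℂ)) (t : ℝ)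
    (c : ∀ n, E.obs n) (ρ : L) (p : ℕ × ℕ × ℕ) :
    Filter.Tendsto (fun ε => E.opTerm ε g t c ρ p) (𝓝[>] 0) (𝓝 (E.opTerm 0 g t c ρ p)) := by
  have : Continuous fun ε => E.opTerm ε g t c ρ p := by
    unfold opTerm
    fun_prop
  exact (this.tendsto 0).mono_left nhdsWithin_le_nhds

theorem opTerm_of_fst_eq_zero (ε : ℝ) (t : ℝ) (c : ∀ n, E.obs n) (ρ : L) (q : ℕ × ℕ) :
    E.opTerm ε g t c ρ (0, q) = E.opTerm 0 g t c ρ (0, q) := by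
  simp [opTerm]

theorem opTerm_zero_of_fst_ne_zero (t : ℝ) (c : ∀ n, E.obs n) (ρ : L) {p : ℕ × ℕ × ℕ}
    (hp : p.1 ≠ 0) : E.opTerm 0 g t c ρ p = 0 := by
  simp [opTerm, hp]

/-- At `ε = 0` the convention `0 ^ 0 = 1` retains the terms with `k = 0`, so the limit can be
written with the same `opTerm`. -/
theorem Quantizes.opTerm_zero_apply (hW : ∀ t ∈ J, ∀ n, E.IsSymm (W t n)) (hg : E.Quantizes J W g)
    {t : ℝ} (ht : t ∈ J) {c : ∀ n, E.obs n} (hc : ∀ n, E.IsSymm (c n)) (ρ : L) (q : ℕ × ℕ) :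
    E.opTerm 0 g t c ρ (0, q) =
      E.diag ρ (E.br 1 (E.contract ρ q.1 (W t (1 + q.1))) (E.contract ρ q.2 (c (1 + q.2)))) /
        ((q.1)! * (q.2)!) := by
  rw [hg.opTerm_eq hW ht 0 hc]
  simp only [pow_zero, Nat.add_zero, Nat.factorial_one, Nat.cast_one, one_mul]
  rw [mul_comm, mul_one_div]

theorem Quantizes.tendsto_opComponent (hW : ∀ t ∈ J, ∀ n, E.IsSymm (W t n))
    (hg : E.Quantizes J W g) {t : ℝ} (ht : t ∈ J) {c : ∀ n, E.obs n} (hc : ∀ n, E.IsSymm (c n))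
    (ρ : L) (d : ℕ) :
    Filter.Tendsto (fun ε => E.opComponent ε g t c ρ d) (𝓝[>] 0)
      (𝓝 (∑ p ∈ (Finset.range d ×ˢ Finset.range d).filter (fun p => 1 + p.1 + p.2 = d),
        E.diag ρ (E.br 1 (E.contract ρ p.1 (W t (1 + p.1))) (E.contract ρ p.2 (c (1 + p.2)))) /
          ((p.1)! * (p.2)!))) := by
  have hlim := tendsto_finsetSum (degreeIndices d) fun p _ => tendsto_opTerm g t c ρ p
  have heq : ∑ p ∈ degreeIndices d, E.opTerm 0 g t c ρ p =
      ∑ p ∈ (Finset.range d ×ˢ Finset.range d).filter (fun p => 1 + p.1 + p.2 = d),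
        E.opTerm 0 g t c ρ (0, p) := by
    rw [← Finset.sum_filter_of_ne (p := fun p => p.1 = 0)
      fun p _ hp => not_imp_comm.mp (opTerm_zero_of_fst_ne_zero t c ρ) hp]
    refine Finset.sum_bij' (fun p _ => p.2) (fun q _ => (0, q)) ?_ ?_ ?_ ?_ ?_
    · intro p hp
      simp only [Finset.mem_filter, mem_degreeIndices] at hp
      simp only [Finset.mem_filter, Finset.mem_product, Finset.mem_range]
      omega
    · intro q hq
      simp only [Finset.mem_filter] at hq
      simp only [Finset.mem_filter, mem_degreeIndices, and_true]
      omega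
    · intro p hp
      exact Prod.ext (Finset.mem_filter.mp hp).2.symm rfl
    · intro q _
      rfl
    · intro p hp
      rw [← (Finset.mem_filter.mp hp).2]
  rw [heq] at hlim
  simpa only [opComponent, hg.opTerm_zero_apply hW ht hc] using hlim

theorem Quantizes.tendsto_op [StarModule ℂ A] (hW : E.IsHamiltonFunctional J W H)
    (hg : E.Quantizes J W g) {t : ℝ} (ht : t ∈ J) {c : ∀ n, E.obs n} (hc : ∀ n, E.IsSymm (c n))
    (hent : E.IsEntire c) (ρ : L) {ε₀ : ℝ} (hε₀ : 0 < ε₀) (hs : Summable (E.opTerm ε₀ g t c ρ)) :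
    ∃ D : ℂ, HasLineDerivAt ℝ (E.toFunctional c) D ρ (S.poisson ρ (H t ρ)) ∧
      Filter.Tendsto (fun ε => E.op ε g t c ρ) (𝓝[>] 0) (𝓝 D) := by
  refine ⟨_, hent.hasLineDerivAt hc ρ _, ?_⟩
  choose w hw using fun a => E.exists_eq_tpow (E.contract ρ a (W t (1 + a)))
  choose x hx using fun b => E.exists_eq_tpow (E.contract ρ b (c (1 + b)))
  have hinj : Function.Injective fun q : ℕ × ℕ => ((0, q) : ℕ × ℕ × ℕ) := fun p q h => by
    simpa using h
  have hterm (q : ℕ × ℕ) : E.opTerm 0 g t c ρ (0, q) =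
      S.pair ρ (P.br (w q.1) (x q.2)) / (q.1 ! * q.2 !) := by
    rw [hg.opTerm_zero_apply hW.symm ht hc, hw, hx, br_tpow_one, diag_tpow, pow_one]
  have hs0 : Summable fun q : ℕ × ℕ => E.opTerm 0 g t c ρ (0, q) :=
    (hs.comp_injective hinj).congr fun q => opTerm_of_fst_eq_zero ε₀ t c ρ q
  -- The surviving double series is summed over `a` first, for fixed `b`, which assembles `H(t, ρ)`
  -- inside the bracket; self-adjointness of `H(t, ρ)` then moves the bracket onto the state.
  have hD : ∑' p, E.opTerm 0 g t c ρ p =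
      ∑' b, E.diag (S.poisson ρ (H t ρ)) (E.contract ρ b (c (1 + b))) / (b ! : ℂ) := by
    rw [← hinj.tsum_eq (f := E.opTerm 0 g t c ρ) fun p hp =>
        ⟨p.2, Prod.ext (not_imp_comm.mp (opTerm_zero_of_fst_ne_zero t c ρ) hp).symm rfl⟩,
      ← (Equiv.prodComm ℕ ℕ).tsum_eq]
    refine hs0.prod_symm.tsum_prod.trans (tsum_congr fun b => ?_)
    rw [hx, diag_tpow, pow_one, S.poisson_spec _ _ (hW.star_eq ht ρ),
      ← (hW.hasSum_pair_br ht ρ hw (x b)).tsum_eq, ← tsum_div_const]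
    refine tsum_congr fun a => ?_
    rw [Prod.swap, hterm, div_div]
  rw [← hD]
  -- For `0 < ε ≤ ε₀` each term is dominated by its value at `ε₀`, since `ε` enters only through `ε
  -- ^ k`.
  refine tendsto_tsum_of_dominated_convergence hs.norm (tendsto_opTerm g t c ρ) ?_
  filter_upwards [Ioc_mem_nhdsGT hε₀] with ε hε p
  simp only [opTerm, norm_div, norm_mul, norm_pow, Complex.norm_real, Real.norm_eq_abs,
    abs_of_pos hε.1, abs_of_pos hε₀]
  gcongr
  exacts [hε.1.le, hε.2]

end ParticleAlgebras

/-! ### The weak Vlasov equation -/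

/-- A linear functional is its own derivative in every direction, so uniqueness of derivatives
forces the value of `D`. -/
theorem weakVlasov_iff {J : Set ℝ} {H : ℝ → L → A} (ρ : ℝ → L) : WeakVlasov S J H ρ ↔
    ∀ t ∈ J, ∀ x : A, ∃ D : ℂ,
      HasLineDerivAt ℝ (fun σ => S.pair σ x) D (ρ t) (S.poisson (ρ t) (H t (ρ t))) ∧
      HasDerivAt (fun τ => S.pair (ρ τ) x) D t := by
  have hlin (σ v : L) (x : A) : HasLineDerivAt ℝ (fun σ => S.pair σ x) (S.pair v x) σ v := by
    have : HasDerivAt (fun s : ℝ => S.pair σ x + s • S.pair v x) ((1 : ℝ) • S.pair v x) 0 :=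
      ((hasDerivAt_id (0 : ℝ)).smul_const _).const_add _
    rw [one_smul] at this
    simpa [HasLineDerivAt] using this
  constructor
  · exact fun h t ht x => ⟨_, hlin _ _ x, h t ht x⟩
  · intro h t ht x
    obtain ⟨D, hD, hρ⟩ := h t ht x
    exact (HasDerivAt.unique hD (hlin _ _ x) : D = _) ▸ hρ

end Particles

end Uniformization

end

/-! ### The main theorem -/

open Uniformization in
theorem mainTheorem1 {L A : Type*} [AddCommGroup L] [Module ℝ L]
    [NonAssocRing A] [StarRing A] [Module ℂ A] [StarModule ℂ A]
    [IsScalarTower ℂ A A] [SMulCommClass ℂ A A]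
    (P : PoissonBracket A) (S : StateSpace L A P) (E : ParticleAlgebras S)
    (J : Set ℝ) (hJ : IsOpen J) (W : ℝ → ∀ n, E.obs n) (H : ℝ → L → A)
    (hW : E.IsHamiltonFunctional J W H) :
    -- the literal substitution of `ρ · (I + ε x)` in `H` is the exponential symbol
    (∀ (ε : ℝ), ∀ t ∈ J, ∀ (ρ : L) (x : A) (n : ℕ),
      ∑ p ∈ Finset.HasAntidiagonal.antidiagonal n, (ε : ℂ) ^ p.1 • E.symbolHamiltonian (W t) p.1 p.2 ρ x =
        (1 / (n ! : ℂ)) • E.contract ρ n (E.mul (1 + n) (W t (1 + n))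
          (E.tprod fun i : Fin (1 + n) => if i.val < n then 1 + (ε : ℂ) • x else 1))) ∧
    -- the symbol can be quantized
    (∃ g, E.Quantizes J W g) ∧
    ∀ g, E.Quantizes J W g →
      -- equivalence, for arbitrary families and formal power series
      (∀ ε : ℝ, 0 < ε → ∀ X : ℝ → ∀ n, E.obs n, (∀ t ∈ J, ∀ n, E.IsSymm (X t n)) →
        (E.Heisenberg ε J W X ↔ E.FormalEquation ε J g fun t => E.repForm ε (X t))) ∧
      -- equivalence, for functionals
      (∀ ε : ℝ, 0 < ε → ∀ X : ℝ → ∀ n, E.obs n, (∀ t ∈ J, ∀ n, E.IsSymm (X t n)) →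
        E.IsRegular ε J g X →
        (E.Heisenberg ε J W X ↔ ∀ t ∈ J, ∀ ρ : L,
          HasDerivAt (fun τ => E.representing ε (X τ) ρ)
            (E.op ε g t (E.repForm ε (X t)) ρ) t)) ∧
      -- the limit `ε → 0` of the operator, for formal power series
      (∀ c : ∀ n, E.obs n, (∀ n, E.IsSymm (c n)) → ∀ t ∈ J, ∀ (ρ : L) (d : ℕ),
        Filter.Tendsto (fun ε => E.opComponent ε g t c ρ d) (𝓝[>] 0)
          (𝓝 (∑ p ∈ (Finset.range d ×ˢ Finset.range d).filter (fun p => 1 + p.1 + p.2 = d),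
            E.diag ρ (E.br 1 (E.contract ρ p.1 (W t (1 + p.1))) (E.contract ρ p.2 (c (1 + p.2)))) /
              ((p.1)! * (p.2)!)))) ∧
      -- the limit `ε → 0` of the operator, for functionals
      (∀ c : ∀ n, E.obs n, (∀ n, E.IsSymm (c n)) → E.IsEntire c → ∀ t ∈ J, ∀ ρ : L,
        ∀ ε₀ : ℝ, 0 < ε₀ → Summable (E.opTerm ε₀ g t c ρ) →
        ∃ D : ℂ, HasLineDerivAt ℝ (E.toFunctional c) D ρ (S.poisson ρ (H t ρ)) ∧
          Filter.Tendsto (fun ε => E.op ε g t c ρ) (𝓝[>] 0) (𝓝 D)) ∧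
      -- the limit equation for `⟨ρ(t), x⟩` is the weak Vlasov equation
      (∀ ρ : ℝ → L, WeakVlasov S J H ρ ↔
        ∀ t ∈ J, ∀ x : A, ∃ D : ℂ,
          HasLineDerivAt ℝ (fun σ => S.pair σ x) D (ρ t) (S.poisson (ρ t) (H t (ρ t))) ∧
          HasDerivAt (fun τ => S.pair (ρ τ) x) D t) := by
  refine ⟨fun ε t ht ρ x n => E.sum_symbolHamiltonian (hW.symm t ht) ε ρ x n,
    ⟨_, E.quantizes_quantumSymbol hW.symm⟩, fun g hg => ⟨?_, ?_, ?_, ?_, ?_⟩⟩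
  · exact fun ε hε X hX => E.heisenberg_iff_formalEquation hW.symm hg hε.ne' hX
  · exact fun ε hε X hX hreg =>
      E.heisenberg_iff_hasDerivAt_representing hJ hW.symm hg hε.ne' hX hreg
  · exact fun c hc t ht ρ d => hg.tendsto_opComponent hW.symm ht hc ρ d
  · exact fun c hc hent t ht ρ ε₀ hε₀ hs => hg.tendsto_op hW ht hc hent ρ hε₀ hs
  · exact fun ρ => weakVlasov_iff ρ
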